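/- There is an absolute constant $C>0$ with the following property. Let $\mathbb F_q$ be a finite field with $q$ elements, where $q\equiv 1 \pmod 4$, let $d=4k-1$ for some integer $k\ge 1$, let $g$ be a primitive element of $\mathbb F_q$ (a generator of the multiplicative group $\mathbb F_q^*$), and let $S_g=\{x\in\mathbb F_q^d : x_1^2+\cdots+x_d^2=g\}$ be the sphere of radius $g$ centred at the origin. Let $\chi$ be any non-trivial additive character of $\mathbb F_q$. For a set $V\subset\mathbb F_q^d$ and a function $f:V\to\mathbb C$ put $$(f\,d\sigma)^\vee(m)=\frac1{|V|}\sum_{x\in V}\chi(m\cdot x)f(x)\qquad(m\in\mathbb F_q^d),$$ and for $1\le p,r\le\infty$ let $R_V^*(p\to r)$ be the smallest real number such that $$\|(f\,d\sigma)^\vee\|_{L^r(\mathbb F_q^d,dc)}\le R_V^*(p\to r)\,\|f\|_{L^p(V,d\sigma)}\qquad\text{for all } f:V\to\mathbb C,$$ where $dc$ is the counting measure on $\mathbb F_q^d$ and $d\sigma$ is the measure on $V$ that gives each point of $V$ mass $1/|V|$. Then $$R_{S_g}^*\!\left(\frac{4d}{3d-2}\to 4\right)\le C.$$ The constant $C$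 does not depend on $q$, $d$, $g$ or $\chi$. -/

import Mathlib

open MeasureTheory
open scoped ENNReal

noncomputable section

namespace FiniteFieldExtension

/-- The sphere `S_j = {x ∈ F^d : x_1^2 + ⋯ + x_d^2 = j}` of radius `j` centred at the origin. -/
def sphere {F : Type*} [Field F] [Fintype F] (d : ℕ) (j : F) : Finset (Fin d → F) :=
  open Classical in Finset.univ.filter fun x => ∑ i, x i ^ 2 = j

/-- `g` is a primitive element of `F`: a generator of the multiplicative group `F^*`. -/
def IsPrimitiveElement {F : Type*} [Field F] (g : F) : Prop :=
  ∃ u : Fˣ, (u : F) = g ∧ ∀ x : Fˣ, x ∈ Subgroup.zpowers u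

/-- The counting measure `dc` on `F^d`; every subset is measurable. -/
def countingMeasure (F : Type*) (d : ℕ) : @Measure (Fin d → F) ⊤ :=
  @Measure.count (Fin d → F) ⊤

/-- The normalized surface measure `dσ` on `V`, which gives each point of `V` mass `1 / |V|`;
every subset is measurable. -/
def surfaceMeasure {F : Type*} {d : ℕ} (V : Finset (Fin d → F)) : @Measure V ⊤ :=
  (V.card : ℝ≥0∞)⁻¹ • @Measure.count V ⊤

/-- The inverse Fourier transform of the measure `f dσ` on `V`,
`(f dσ)^∨(m) = |V|⁻¹ ∑_{x ∈ V} χ(m · x) f(x)`. -/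
def extension {F : Type*} [Field F] {d : ℕ} (χ : AddChar F ℂ) (V : Finset (Fin d → F))
    (f : V → ℂ) (m : Fin d → F) : ℂ :=
  (V.card : ℂ)⁻¹ * ∑ x : V, χ (m ⬝ᵥ (x : Fin d → F)) * f x

/-- `R_V^*(p → r)`: the smallest `A` such that
`‖(f dσ)^∨‖_{L^r(F^d, dc)} ≤ A ‖f‖_{L^p(V, dσ)}` for all `f : V → ℂ`
(it would be `∞` if there were no finite such `A`). -/
def extensionConstant {F : Type*} [Field F] {d : ℕ} (χ : AddChar F ℂ)
    (V : Finset (Fin d → F)) (p r : ℝ≥0∞) : ℝ≥0∞ :=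
  sInf {A : ℝ≥0∞ | ∀ f : V → ℂ,
    eLpNorm (extension χ V f) r (countingMeasure F d) ≤ A * eLpNorm f p (surfaceMeasure V)}

end FiniteFieldExtension

end

noncomputable section

namespace FiniteFieldExtension

open Classical in
/-- A system of `k` linearly independent linear equations in `d` unknowns has `q ^ (d - k)`
solutions. -/
theorem card_linear_system {F : Type*} [Field F] [Fintype F] {d k : ℕ}
    (v : Fin k → Fin d → F) (hv : LinearIndependent F v) (c : Fin k → F) :
    (Finset.univ.filter fun x : Fin d → F => ∀ i, x ⬝ᵥ v i = c i).card * Fintype.card F ^ k =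
      Fintype.card F ^ d := by
  let φ : (Fin d → F) →ₗ[F] (Fin k → F) := Matrix.mulVecLin (Matrix.of v)
  have hφ : ∀ x i, φ x i = x ⬝ᵥ v i := fun x i => by
    simp [φ, Matrix.mulVec, dotProduct_comm]
  have hsurj : Function.Surjective φ := by
    rw [← LinearMap.range_eq_top]
    apply Submodule.eq_top_of_finrank_eq
    have := LinearIndependent.rank_matrix (M := Matrix.of v) hv
    rw [Matrix.rank] at this
    simpa using this
  have hfib : ∀ c' : Fin k → F, (Finset.univ.filter fun x => φ x = c').card =
      (Finset.univ.filter fun x => φ x = c).card := fun c' =>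
    AddMonoidHom.card_fiber_eq_of_mem_range φ (hsurj c') (hsurj c)
  have htot : Fintype.card (Fin d → F) = ∑ c' : Fin k → F,
      (Finset.univ.filter fun x => φ x = c').card :=
    Finset.card_eq_sum_card_fiberwise (fun x _ => Finset.mem_univ _)
  rw [Finset.sum_congr rfl fun c' _ => hfib c'] at htot
  simp only [Finset.sum_const, Finset.card_univ, smul_eq_mul, Fintype.card_fun,
    Fintype.card_fin] at htot
  rw [htot, mul_comm]
  congr 3
  ext x
  simp [funext_iff, hφ]

/-- The indicator function of the relation `v ⊥ u`. -/
def orthInd {F : Type*} [Field F] {d : ℕ} (u v : Fin d → F) : ℝ :=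
  open Classical in if v ⬝ᵥ u = 0 then 1 else 0

section Correlation

variable {F : Type*} [Field F] {d : ℕ}

open Classical in
theorem sum_orthInd_eq (A : Finset (Fin d → F)) (u : Fin d → F) :
    (∑ v ∈ A, orthInd u v) = ((A.filter fun v => v ⬝ᵥ u = 0).card : ℝ) := by
  simp only [orthInd]
  rw [← Finset.sum_filter]
  simp

open Classical in
theorem sum_orthInd_mul_eq (A : Finset (Fin d → F)) (u w : Fin d → F) :
    (∑ v ∈ A, orthInd u v * orthInd w v) =
      ((A.filter fun v => v ⬝ᵥ u = 0 ∧ v ⬝ᵥ w = 0).card : ℝ) := by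
  simp only [orthInd, mul_ite, mul_one, mul_zero, ← ite_and]
  rw [← Finset.sum_filter]
  simp [and_comm]

/-- Two vectors `u` with `u · u = -2 u · z ≠ 0` that are proportional are equal. -/
theorem eq_of_smul_eq {z u w : Fin d → F} (hu : u ⬝ᵥ u = -2 * (u ⬝ᵥ z))
    (hw : w ⬝ᵥ w = -2 * (w ⬝ᵥ z)) (hw0 : w ⬝ᵥ w ≠ 0) {c : F} (hc : w = c • u) : w = u := by
  have hc0 : c ≠ 0 := by
    rintro rfl
    simp [hc] at hw0
  have h1 : c * (c * (u ⬝ᵥ u)) = c * (u ⬝ᵥ u) := by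
    have := hw
    rw [hc] at this
    simp only [dotProduct_smul, smul_dotProduct, smul_eq_mul] at this
    rw [this, hu]; ring
  have huu : u ⬝ᵥ u ≠ 0 := by
    intro h
    rw [hc] at hw0
    simp [h] at hw0
  have h3 : c * (c * (u ⬝ᵥ u)) = c * (1 * (u ⬝ᵥ u)) := by rw [h1, one_mul]
  have : c = 1 := mul_right_cancel₀ huu (mul_left_cancel₀ hc0 h3)
  rw [hc, this, one_smul]

theorem sum_correlation_expand (A : Finset (Fin d → F)) (u w : Fin d → F) (e : ℝ) :
    (∑ v ∈ A, (orthInd u v - e) * (orthInd w v - e)) =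
      (∑ v ∈ A, orthInd u v * orthInd w v) - e * (∑ v ∈ A, orthInd u v)
        - e * (∑ v ∈ A, orthInd w v) + e ^ 2 * A.card := by
  rw [Finset.mul_sum, Finset.mul_sum, ← Finset.sum_sub_distrib, ← Finset.sum_sub_distrib]
  rw [show e ^ 2 * (A.card : ℝ) = ∑ v ∈ A, e ^ 2 by simp [mul_comm], ← Finset.sum_add_distrib]
  exact Finset.sum_congr rfl fun v _ => by ring

variable [Fintype F]

open Classical in
/-- The affine hyperplane `{v : v · z = -1/2}`. -/
def halfPlane (z : Fin d → F) : Finset (Fin d → F) :=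
  Finset.univ.filter fun v => v ⬝ᵥ z = -(1 / 2)

theorem card_halfPlane (z : Fin d → F) (hz : z ≠ 0) :
    ((halfPlane z).card : ℝ) * Fintype.card F = (Fintype.card F : ℝ) ^ d := by
  classical
  have h := card_linear_system ![z] (by simpa [linearIndependent_unique_iff] using hz)
    ![-(1 / 2)]
  simp only [Fin.forall_fin_one, pow_one] at h
  rw [← Nat.cast_pow, ← h]
  push_cast
  rfl

theorem sum_orthInd_cases (h2 : (2 : F) ≠ 0) (z u : Fin d → F) (hz : z ≠ 0) (hu : u ≠ 0) :
    ((∑ v ∈ halfPlane z, orthInd u v) * (Fintype.card F : ℝ) ^ 2 = (Fintype.card F : ℝ) ^ d) ∨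
      ((∀ v ∈ halfPlane z, orthInd u v = 0) ∧ ∃ c : F, u = c • z) := by
  classical
  by_cases hli : LinearIndependent F ![z, u]
  · left
    have h := card_linear_system ![z, u] hli ![-(1 / 2), 0]
    rw [sum_orthInd_eq, ← Nat.cast_pow _ d, ← h]
    push_cast
    congr 2
    simp [halfPlane, Fin.forall_fin_two, Finset.filter_filter]
  · right
    rw [LinearIndependent.pair_iff] at hli
    push Not at hli
    obtain ⟨a, b, hab, hne⟩ := hli
    have hb : b ≠ 0 := by
      intro hb
      have ha : a ≠ 0 := fun ha => hne ha hb
      simp [hb, ha, hz] at hab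
    have huz : u = (-(a / b)) • z := by
      have : b • u = -(a • z) := eq_neg_of_add_eq_zero_right hab
      rw [neg_smul, div_eq_inv_mul, mul_smul, ← smul_neg, ← this, smul_smul,
        inv_mul_cancel₀ hb, one_smul]
    refine ⟨fun v hv => ?_, _, huz⟩
    simp only [halfPlane, Finset.mem_filter, Finset.mem_univ, true_and] at hv
    simp only [orthInd, ite_eq_right_iff, one_ne_zero, imp_false]
    intro h0
    rw [huz, dotProduct_smul, hv, smul_eq_mul] at h0
    have hc : (-(a / b)) = 0 := by
      rcases mul_eq_zero.mp h0 with h | h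
      · exact h
      · exact absurd h (by simp [h2])
    rw [hc, zero_smul] at huz
    exact hu huz

theorem sum_orthInd_mul_le (h2 : (2 : F) ≠ 0) (z u w : Fin d → F) (hu : u ≠ 0)
    (huw : ∀ c : F, w ≠ c • u) :
    (∑ v ∈ halfPlane z, orthInd u v * orthInd w v) * (Fintype.card F : ℝ) ^ 3 ≤
      (Fintype.card F : ℝ) ^ d := by
  classical
  rw [sum_orthInd_mul_eq]
  by_cases hli : LinearIndependent F ![z, u, w]
  · have h := card_linear_system ![z, u, w] hli ![-(1 / 2), 0, 0]
    apply le_of_eq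
    rw [← Nat.cast_pow _ d, ← h]
    push_cast
    congr 2
    simp [halfPlane, Fin.forall_fin_succ, Finset.filter_filter]
  · rw [Finset.card_eq_zero.mpr]
    · simp
    · rw [Finset.filter_eq_empty_iff]
      rintro v hv ⟨hvu, hvw⟩
      simp only [halfPlane, Finset.mem_filter, Finset.mem_univ, true_and] at hv
      apply hli
      rw [Fintype.linearIndependent_iff]
      intro c hc
      simp only [Fin.sum_univ_three, Matrix.cons_val] at hc
      have h0 : c 0 = 0 := by
        have := congrArg (fun t => v ⬝ᵥ t) hc
        simp only [dotProduct_add, dotProduct_smul, hv, hvu, hvw, dotProduct_zero, smul_eq_mul,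
          mul_zero, add_zero] at this
        simpa [h2] using this
      rw [h0, zero_smul, zero_add] at hc
      have hc2 : c 2 = 0 := by
        by_contra h
        apply huw (-(c 1 / c 2))
        have : c 2 • w = -(c 1 • u) := eq_neg_of_add_eq_zero_right hc
        rw [neg_smul, div_eq_inv_mul, mul_smul, ← smul_neg, ← this, smul_smul,
          inv_mul_cancel₀ h, one_smul]
      rw [hc2, zero_smul, add_zero] at hc
      have h1 : c 1 = 0 := (smul_eq_zero.mp hc).resolve_right hu
      intro i
      fin_cases i <;> assumption

/-- The balanced indicators of distinct orthogonal complements are nonpositively correlated. -/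
theorem correlation_le (h2 : (2 : F) ≠ 0) {z u w : Fin d → F} (hz : z ⬝ᵥ z ≠ 0)
    (hu : u ⬝ᵥ u = -2 * (u ⬝ᵥ z)) (hu0 : u ⬝ᵥ u ≠ 0)
    (hw : w ⬝ᵥ w = -2 * (w ⬝ᵥ z)) (hw0 : w ⬝ᵥ w ≠ 0) (huw : u ≠ w) :
    (∑ v ∈ halfPlane z, (orthInd u v - (Fintype.card F : ℝ)⁻¹) *
      (orthInd w v - (Fintype.card F : ℝ)⁻¹)) ≤ 0 := by
  have hz' : z ≠ 0 := by rintro rfl; simp at hz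
  have hu' : u ≠ 0 := by rintro rfl; simp at hu0
  have hw' : w ≠ 0 := by rintro rfl; simp at hw0
  have hq : (0 : ℝ) < Fintype.card F := by exact_mod_cast Fintype.card_pos
  have hA := card_halfPlane z hz'
  have hwu : ∀ c : F, w ≠ c • u := fun c hc => huw (eq_of_smul_eq hu hw hw0 hc).symm
  rw [sum_correlation_expand]
  have hm := sum_orthInd_mul_le h2 z u w hu' hwu
  set q : ℝ := (Fintype.card F : ℝ)
  set n := ∑ v ∈ halfPlane z, orthInd u v * orthInd w v with hn
  suffices h : q ^ 3 * (n - q⁻¹ * (∑ v ∈ halfPlane z, orthInd u v)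
        - q⁻¹ * (∑ v ∈ halfPlane z, orthInd w v) + q⁻¹ ^ 2 * (halfPlane z).card) ≤ 0 by
    by_contra hcon
    push Not at hcon
    have := mul_pos (pow_pos hq 3) hcon
    linarith
  have hexp : q ^ 3 * (n - q⁻¹ * (∑ v ∈ halfPlane z, orthInd u v)
        - q⁻¹ * (∑ v ∈ halfPlane z, orthInd w v) + q⁻¹ ^ 2 * (halfPlane z).card) =
      n * q ^ 3 - (∑ v ∈ halfPlane z, orthInd u v) * q ^ 2
        - (∑ v ∈ halfPlane z, orthInd w v) * q ^ 2 + (halfPlane z).card * q := by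
    field_simp
  rw [hexp, hA]
  rcases sum_orthInd_cases h2 z u hz' hu' with h1 | ⟨h1, c, hc⟩
  · rcases sum_orthInd_cases h2 z w hz' hw' with h3 | ⟨h3, c', hc'⟩
    · rw [h1, h3]; linarith
    · have hn0 : n = 0 := Finset.sum_eq_zero fun v hv => by rw [h3 v hv, mul_zero]
      rw [h1, Finset.sum_eq_zero h3, hn0]; simp [q]
  · rcases sum_orthInd_cases h2 z w hz' hw' with h3 | ⟨h3, c', hc'⟩
    · have hn0 : n = 0 := Finset.sum_eq_zero fun v hv => by rw [h1 v hv, zero_mul]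
      rw [h3, Finset.sum_eq_zero h1, hn0]; simp [q]
    · exfalso
      have hc0 : c ≠ 0 := by rintro rfl; simp [hc] at hu'
      apply hwu (c' * c⁻¹)
      rw [hc, smul_smul, mul_assoc, inv_mul_cancel₀ hc0, mul_one, hc']

theorem correlation_self_le (h2 : (2 : F) ≠ 0) {z u : Fin d → F} (hz : z ≠ 0) (hu : u ≠ 0) :
    (∑ v ∈ halfPlane z, (orthInd u v - (Fintype.card F : ℝ)⁻¹) *
      (orthInd u v - (Fintype.card F : ℝ)⁻¹)) * (Fintype.card F : ℝ) ^ 2 ≤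
      (Fintype.card F : ℝ) ^ d := by
  have hq : (1 : ℝ) ≤ Fintype.card F := by exact_mod_cast Fintype.card_pos
  have hA := card_halfPlane z hz
  have hsq : ∀ v, orthInd u v * orthInd u v = orthInd u v := fun v => by
    unfold orthInd; split_ifs <;> simp
  rw [sum_correlation_expand]
  simp only [hsq]
  set q : ℝ := (Fintype.card F : ℝ)
  set n := ∑ v ∈ halfPlane z, orthInd u v
  have hn : n * q ^ 2 ≤ q ^ d ∧ 0 ≤ n ∧ (q ^ d ≤ n * q ^ 2 ∨ n = 0) := by
    rcases sum_orthInd_cases h2 z u hz hu with h1 | ⟨h1, -⟩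
    · refine ⟨h1.le, Finset.sum_nonneg fun v _ => ?_, Or.inl h1.ge⟩
      unfold orthInd; split_ifs <;> simp
    · have : n = 0 := Finset.sum_eq_zero h1
      rw [this]
      refine ⟨by rw [zero_mul]; positivity, le_rfl, Or.inr rfl⟩
  have hexp : (n - q⁻¹ * n - q⁻¹ * n + q⁻¹ ^ 2 * (halfPlane z).card) * q ^ 2 =
      n * q ^ 2 - 2 * (n * q) + (halfPlane z).card := by
    field_simp; ring
  rw [hexp]
  have hA' : ((halfPlane z).card : ℝ) ≤ q ^ d := by
    rw [← hA]; exact le_mul_of_one_le_right (Nat.cast_nonneg _) hq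
  rcases hn with ⟨h1, h3, h4 | h4⟩
  · have : ((halfPlane z).card : ℝ) ≤ n * q := by
      rw [← hA] at h4
      have : ((halfPlane z).card : ℝ) * q ≤ (n * q) * q := by linarith
      exact le_of_mul_le_mul_right this (by linarith)
    have hnq : 0 ≤ n * q := by positivity
    linarith
  · rw [h4]; simpa using hA'

end Correlation

section Chords

variable {F : Type*} [Field F] [Fintype F] {d : ℕ}

/-- The bound `q⁻¹ (∑ h)² + q^((d - 2) / 2) ∑ h²` for quadratic forms in `h` over `V`. -/
def pairBound (V : Finset (Fin d → F)) (h : (Fin d → F) → ℝ) : ℝ :=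
  (Fintype.card F : ℝ)⁻¹ * (∑ x ∈ V, h x) ^ 2 +
    (Fintype.card F : ℝ)⁻¹ * √((Fintype.card F : ℝ) ^ d) * ∑ x ∈ V, h x ^ 2

theorem pairBound_mono {V W : Finset (Fin d → F)} (hVW : V ⊆ W) {h : (Fin d → F) → ℝ}
    (hh : ∀ x, 0 ≤ h x) : pairBound V h ≤ pairBound W h := by
  have h1 : ∑ x ∈ V, h x ≤ ∑ x ∈ W, h x :=
    Finset.sum_le_sum_of_subset_of_nonneg hVW fun x _ _ => hh x
  have h2 : ∑ x ∈ V, h x ^ 2 ≤ ∑ x ∈ W, h x ^ 2 :=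
    Finset.sum_le_sum_of_subset_of_nonneg hVW fun x _ _ => sq_nonneg _
  have h0 : 0 ≤ ∑ x ∈ V, h x := Finset.sum_nonneg fun x _ => hh x
  unfold pairBound
  gcongr

omit [Fintype F] in
theorem chord_dotProduct_self {g : F} {x z : Fin d → F} (hx : x ⬝ᵥ x = g) (hz : z ⬝ᵥ z = g) :
    (x - z) ⬝ᵥ (x - z) = -2 * ((x - z) ⬝ᵥ z) := by
  simp only [sub_dotProduct, dotProduct_sub, hx, hz, dotProduct_comm z x]
  ring

/-- The second moment over `halfPlane z` of a weighted sum of balanced indicators of the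
orthogonal complements of non-isotropic chords through `z`. -/
theorem sum_balanced_sq_le (h2 : (2 : F) ≠ 0) {g : F} (hg : g ≠ 0) {z : Fin d → F}
    (hz : z ⬝ᵥ z = g) (X : Finset (Fin d → F)) (hX : ∀ x ∈ X, x ⬝ᵥ x = g)
    (hX0 : ∀ x ∈ X, (x - z) ⬝ᵥ (x - z) ≠ 0) (h : (Fin d → F) → ℝ) (hh : ∀ x, 0 ≤ h x) :
    (∑ v ∈ halfPlane z, (∑ y ∈ X, h y * (orthInd (y - z) v - (Fintype.card F : ℝ)⁻¹)) ^ 2) *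
      (Fintype.card F : ℝ) ^ 2 ≤ (Fintype.card F : ℝ) ^ d * ∑ x ∈ X, h x ^ 2 := by
  classical
  have hz0 : z ≠ 0 := by rintro rfl; simp at hz; exact hg hz.symm
  set K : (Fin d → F) → (Fin d → F) → ℝ := fun y y' =>
    ∑ v ∈ halfPlane z, (orthInd (y - z) v - (Fintype.card F : ℝ)⁻¹) *
      (orthInd (y' - z) v - (Fintype.card F : ℝ)⁻¹) with hK
  have hexp : (∑ v ∈ halfPlane z,
      (∑ y ∈ X, h y * (orthInd (y - z) v - (Fintype.card F : ℝ)⁻¹)) ^ 2) =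
      ∑ y ∈ X, ∑ y' ∈ X, h y * h y' * K y y' := by
    simp only [sq, Finset.sum_mul_sum]
    simp only [hK, Finset.mul_sum]
    rw [Finset.sum_comm]
    refine Finset.sum_congr rfl fun y _ => ?_
    rw [Finset.sum_comm]
    exact Finset.sum_congr rfl fun y' _ => Finset.sum_congr rfl fun v _ => by ring
  rw [hexp, Finset.sum_mul, Finset.mul_sum]
  refine Finset.sum_le_sum fun y hy => ?_
  have hd := correlation_self_le h2 hz0 (u := y - z) (by
    intro h0; exact hX0 y hy (by simp [h0]))
  calc (∑ y' ∈ X, h y * h y' * K y y') * (Fintype.card F : ℝ) ^ 2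
      ≤ (h y * h y * K y y) * (Fintype.card F : ℝ) ^ 2 := by
        gcongr
        rw [← Finset.add_sum_erase X _ hy]
        have : ∑ y' ∈ X.erase y, h y * h y' * K y y' ≤ 0 := by
          refine Finset.sum_nonpos fun y' hy' => ?_
          have hne := Finset.ne_of_mem_erase hy'
          have hy'X := Finset.mem_of_mem_erase hy'
          refine mul_nonpos_of_nonneg_of_nonpos (mul_nonneg (hh y) (hh y')) ?_
          refine correlation_le h2 (by rwa [hz]) (chord_dotProduct_self (hX y hy) hz)
            (hX0 y hy) (chord_dotProduct_self (hX y' hy'X) hz) (hX0 y' hy'X) ?_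
          intro heq
          exact hne (sub_left_injective heq).symm
        linarith
    _ = (K y y * (Fintype.card F : ℝ) ^ 2) * h y ^ 2 := by ring
    _ ≤ _ := mul_le_mul_of_nonneg_right hd (sq_nonneg _)

open Classical in
/-- Pairs of orthogonal non-isotropic chords of a sphere through a fixed point `z`. -/
theorem sum_orthogonal_chords_le (h2 : (2 : F) ≠ 0) {g : F} (hg : g ≠ 0) {z : Fin d → F}
    (hz : z ⬝ᵥ z = g) (V : Finset (Fin d → F)) (hV : ∀ x ∈ V, x ⬝ᵥ x = g)
    (h : (Fin d → F) → ℝ) (hh : ∀ x, 0 ≤ h x) :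
    ∑ x ∈ V, ∑ y ∈ V, (if (x - z) ⬝ᵥ (x - z) ≠ 0 ∧ (y - z) ⬝ᵥ (y - z) ≠ 0 ∧
      (x - z) ⬝ᵥ (y - z) = 0 then h x * h y else 0) ≤ pairBound V h := by
  set X := V.filter fun x => (x - z) ⬝ᵥ (x - z) ≠ 0 with hXdef
  have hXV : X ⊆ V := Finset.filter_subset _ _
  have hX : ∀ x ∈ X, x ⬝ᵥ x = g := fun x hx => hV x (hXV hx)
  have hX0 : ∀ x ∈ X, (x - z) ⬝ᵥ (x - z) ≠ 0 := fun x hx => (Finset.mem_filter.mp hx).2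
  refine le_trans ?_ (pairBound_mono hXV hh)
  have hq : (0 : ℝ) < Fintype.card F := by exact_mod_cast Fintype.card_pos
  set p : (Fin d → F) → (Fin d → F) := fun x => ((x - z) ⬝ᵥ (x - z))⁻¹ • (x - z) with hp
  set T : (Fin d → F) → ℝ := fun v =>
    ∑ y ∈ X, h y * (orthInd (y - z) v - (Fintype.card F : ℝ)⁻¹) with hT
  have hlhs : ∑ x ∈ V, ∑ y ∈ V, (if (x - z) ⬝ᵥ (x - z) ≠ 0 ∧ (y - z) ⬝ᵥ (y - z) ≠ 0 ∧
      (x - z) ⬝ᵥ (y - z) = 0 then h x * h y else 0) =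
      (Fintype.card F : ℝ)⁻¹ * (∑ x ∈ X, h x) ^ 2 + ∑ x ∈ X, h x * T (p x) := by
    have h1 : ∀ x ∈ X, h x * T (p x) = (∑ y ∈ X, h x * h y * orthInd (y - z) (x - z)) -
        (Fintype.card F : ℝ)⁻¹ * (h x * ∑ y ∈ X, h y) := by
      intro x hx
      simp only [hT, Finset.mul_sum]
      rw [← Finset.sum_sub_distrib]
      refine Finset.sum_congr rfl fun y _ => ?_
      have : orthInd (y - z) (p x) = orthInd (y - z) (x - z) := by
        simp only [orthInd, hp, smul_dotProduct, smul_eq_mul, mul_eq_zero,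
          inv_ne_zero (hX0 x hx), false_or]
      rw [this]; ring
    rw [Finset.sum_congr rfl h1, Finset.sum_sub_distrib, ← Finset.mul_sum, ← Finset.sum_mul, sq,
      add_sub_cancel, hXdef, Finset.sum_filter]
    refine Finset.sum_congr rfl fun x _ => ?_
    split_ifs with hx
    · rw [Finset.sum_filter]
      refine Finset.sum_congr rfl fun y _ => ?_
      simp only [orthInd, mul_ite, mul_one, mul_zero, ← ite_and]
      simp only [ne_eq, hx, not_false_eq_true, true_and]
    · refine Finset.sum_eq_zero fun y _ => by rw [if_neg]; tauto
  have hinj : Set.InjOn p X := by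
    intro x hx y hy hxy
    have hx0 := hX0 x hx
    have hy0 := hX0 y hy
    have : x - z = y - z := by
      refine eq_of_smul_eq (chord_dotProduct_self (hX y hy) hz)
        (chord_dotProduct_self (hX x hx) hz) hx0
        (c := (x - z) ⬝ᵥ (x - z) * ((y - z) ⬝ᵥ (y - z))⁻¹) ?_
      rw [mul_smul]
      change x - z = _ • p y
      rw [← hxy]
      simp only [hp, smul_smul, mul_inv_cancel₀ hx0, one_smul]
    exact sub_left_injective this
  have hmaps : X.image p ⊆ halfPlane z := by
    intro v hv
    obtain ⟨x, hx, rfl⟩ := Finset.mem_image.mp hv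
    have hx0 := hX0 x hx
    have hc := chord_dotProduct_self (hX x hx) hz
    have hxz : (x - z) ⬝ᵥ z ≠ 0 := by
      intro h0; rw [h0, mul_zero] at hc; exact hx0 hc
    simp only [halfPlane, Finset.mem_filter, Finset.mem_univ, true_and, hp, smul_dotProduct,
      smul_eq_mul]
    rw [hc]
    field_simp
  have hTsum : (∑ x ∈ X, T (p x) ^ 2) * (Fintype.card F : ℝ) ^ 2 ≤
      (Fintype.card F : ℝ) ^ d * ∑ x ∈ X, h x ^ 2 := by
    refine le_trans ?_ (sum_balanced_sq_le h2 hg hz X hX hX0 h hh)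
    gcongr
    rw [← Finset.sum_image (f := fun v => T v ^ 2) hinj]
    exact Finset.sum_le_sum_of_subset_of_nonneg hmaps fun v _ _ => sq_nonneg _
  rw [hlhs, pairBound]
  gcongr
  have hS : 0 ≤ ∑ x ∈ X, h x ^ 2 := Finset.sum_nonneg fun x _ => sq_nonneg _
  refine le_of_pow_le_pow_left₀ two_ne_zero (by positivity) ?_
  refine (Finset.sum_mul_sq_le_sq_mul_sq X h fun x => T (p x)).trans ?_
  rw [mul_pow, mul_pow, Real.sq_sqrt (by positivity)]
  have : ∑ x ∈ X, T (p x) ^ 2 ≤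
      ((Fintype.card F : ℝ)⁻¹) ^ 2 * ((Fintype.card F : ℝ) ^ d * ∑ x ∈ X, h x ^ 2) := by
    rw [inv_pow, ← div_eq_inv_mul, le_div_iff₀ (by positivity)]
    exact hTsum
  calc (∑ x ∈ X, h x ^ 2) * ∑ x ∈ X, T (p x) ^ 2 ≤ (∑ x ∈ X, h x ^ 2) *
        (((Fintype.card F : ℝ)⁻¹) ^ 2 * ((Fintype.card F : ℝ) ^ d * ∑ x ∈ X, h x ^ 2)) := by
        gcongr
    _ = _ := by ring

end Chords

section GaussSums

variable {F : Type*} [Field F] [Fintype F]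

/-- The quadratic exponential sum `∑ χ(t x²)`. -/
def quadSum (χ : AddChar F ℂ) (t : F) : ℂ := ∑ x : F, χ (t * x ^ 2)

open Classical in
theorem sum_addChar_mul {χ : AddChar F ℂ} (hχ : χ ≠ 1) (a : F) :
    ∑ t : F, χ (t * a) = if a = 0 then (Fintype.card F : ℂ) else 0 := by
  rw [AddChar.sum_mulShift a (AddChar.IsPrimitive.of_ne_one hχ)]
  split_ifs <;> simp

theorem quadSum_mul_sq (χ : AddChar F ℂ) (t : F) {i : F} (hi : i ≠ 0) :
    quadSum χ (t * i ^ 2) = quadSum χ t := by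
  unfold quadSum
  refine Fintype.sum_equiv (Equiv.mulLeft₀ i hi) _ _ fun x => ?_
  simp only [Equiv.mulLeft₀_apply]
  congr 1; ring

theorem quadSum_sq {χ : AddChar F ℂ} (hχ : χ ≠ 1) (h2 : (2 : F) ≠ 0) {i : F} (hi : i ^ 2 = -1)
    {t : F} (ht : t ≠ 0) : quadSum χ t ^ 2 = Fintype.card F := by
  classical
  have hi0 : i ≠ 0 := by rintro rfl; simp at hi
  have h1 : quadSum χ t ^ 2 = quadSum χ (-t) * quadSum χ t := by
    rw [sq]; congr 1
    rw [← quadSum_mul_sq χ t hi0, hi, mul_neg_one]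
  rw [h1]
  unfold quadSum
  rw [Finset.sum_mul_sum]
  have h3 : ∀ y : F, ∑ x : F, χ (-t * y ^ 2) * χ (t * x ^ 2) =
      ∑ w : F, χ (t * w ^ 2) * χ (y * (2 * t * w)) := by
    intro y
    refine (Fintype.sum_equiv (Equiv.addLeft y) _ _ fun w => ?_).symm
    simp only [Equiv.coe_addLeft, ← AddChar.map_add_eq_mul]
    congr 1; ring
  rw [Finset.sum_congr rfl fun y _ => h3 y, Finset.sum_comm]
  simp only [← Finset.mul_sum, sum_addChar_mul hχ]
  rw [Finset.sum_eq_single 0]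
  · simp
  · intro w _ hw
    simp [h2, ht, hw]
  · simp

theorem quadSum_eq_gauss {χ : AddChar F ℂ} (hχ : χ ≠ 1) (hF : ringChar F ≠ 2)
    [DecidableEq F] {t : F} (ht : t ≠ 0) :
    quadSum χ t = ∑ y : F, χ (t * y) * (quadraticChar F y : ℂ) := by
  have h0 : ∑ y : F, χ (t * y) = 0 := by
    have := sum_addChar_mul hχ t
    simp only [ht, if_false] at this
    rw [← this]
    exact Finset.sum_congr rfl fun y _ => by rw [mul_comm]
  unfold quadSum
  rw [← Finset.sum_fiberwise Finset.univ (fun x : F => x ^ 2)]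
  have : ∀ y : F, ∑ x with x ^ 2 = y, χ (t * x ^ 2) =
      χ (t * y) * (quadraticChar F y : ℂ) + χ (t * y) := by
    intro y
    rw [Finset.sum_congr rfl (g := fun _ => χ (t * y))
      (fun x hx => by rw [(Finset.mem_filter.mp hx).2]), Finset.sum_const, nsmul_eq_mul]
    have hc := quadraticChar_card_sqrts hF y
    have hc' : ((Finset.univ.filter fun x : F => x ^ 2 = y).card : ℤ) =
        quadraticChar F y + 1 := by
      rw [← hc]; congr 2; ext x; simp
    have hc'' : ((Finset.univ.filter fun x : F => x ^ 2 = y).card : ℂ) =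
        (quadraticChar F y : ℂ) + 1 := by exact_mod_cast hc'
    rw [hc'']; ring
  rw [Finset.sum_congr rfl fun y _ => this y, Finset.sum_add_distrib, h0, add_zero]

theorem quadSum_nonsquare {χ : AddChar F ℂ} (hχ : χ ≠ 1) (hF : ringChar F ≠ 2) {g : F}
    (hg : ¬IsSquare g) {t : F} (ht : t ≠ 0) : quadSum χ (g * t) = -quadSum χ t := by
  classical
  have hg0 : g ≠ 0 := by rintro rfl; exact hg (IsSquare.zero)
  rw [quadSum_eq_gauss hχ hF (mul_ne_zero hg0 ht), quadSum_eq_gauss hχ hF ht,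
    ← Finset.sum_neg_distrib]
  refine Fintype.sum_equiv (Equiv.mulLeft₀ g hg0) _ _ fun y => ?_
  have : quadraticChar F g = -1 := quadraticChar_neg_one_iff_not_isSquare.mpr hg
  simp only [Equiv.mulLeft₀_apply, map_mul, this]
  push_cast
  rw [show t * (g * y) = g * t * y by ring]
  ring

theorem sum_quad_linear (χ : AddChar F ℂ) (h2 : (2 : F) ≠ 0) {t : F} (ht : t ≠ 0) (u : F) :
    ∑ x : F, χ (t * x ^ 2 + u * x) = χ (-(u ^ 2 / (4 * t))) * quadSum χ t := by
  have h4 : (4 : F) ≠ 0 := by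
    rw [show (4 : F) = 2 * 2 by norm_num]; exact mul_ne_zero h2 h2
  rw [quadSum, Finset.mul_sum]
  refine Fintype.sum_equiv (Equiv.addRight (u / (2 * t))) _ _ fun x => ?_
  simp only [Equiv.coe_addRight, ← AddChar.map_add_eq_mul]
  congr 1; field_simp; ring

omit [Fintype F] in
theorem addChar_sum_eq_prod {ι : Type*} (χ : AddChar F ℂ) (s : Finset ι) (f : ι → F) :
    χ (∑ i ∈ s, f i) = ∏ i ∈ s, χ (f i) := by
  classical
  induction s using Finset.induction_on with
  | empty => simp
  | insert a s ha ih => rw [Finset.sum_insert ha, Finset.prod_insert ha,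
      AddChar.map_add_eq_mul, ih]

theorem sum_quad_linear_pi (χ : AddChar F ℂ) (h2 : (2 : F) ≠ 0) {d : ℕ} {t : F} (ht : t ≠ 0)
    (u : Fin d → F) :
    ∑ m : Fin d → F, χ (t * (m ⬝ᵥ m) + m ⬝ᵥ u) =
      χ (-((u ⬝ᵥ u) / (4 * t))) * quadSum χ t ^ d := by
  classical
  have h1 : ∀ m : Fin d → F, χ (t * (m ⬝ᵥ m) + m ⬝ᵥ u) =
      ∏ i, χ (t * m i ^ 2 + u i * m i) := by
    intro m
    rw [← addChar_sum_eq_prod]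
    congr 1
    simp only [dotProduct, Finset.mul_sum]
    rw [← Finset.sum_add_distrib]
    exact Finset.sum_congr rfl fun i _ => by ring
  rw [Finset.sum_congr rfl fun m _ => h1 m]
  have h3 := Finset.prod_univ_sum (fun _ : Fin d => (Finset.univ : Finset F))
    (fun i x => χ (t * x ^ 2 + u i * x))
  rw [Fintype.piFinset_univ] at h3
  rw [← h3]
  simp only [sum_quad_linear χ h2 ht, Finset.prod_mul_distrib, Finset.prod_const,
    Finset.card_univ, Fintype.card_fin]
  rw [← addChar_sum_eq_prod]
  congr 2
  simp only [dotProduct, Finset.sum_neg_distrib, Finset.sum_div]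
  congr 1
  exact Finset.sum_congr rfl fun i _ => by rw [sq]

/-- The Fourier transform of `χ(τ (m · m - m₀² / g))` when this form in `d + 1 = 2 l` variables
is elliptic. -/
theorem sum_elliptic {χ : AddChar F ℂ} (hχ : χ ≠ 1) (h2 : (2 : F) ≠ 0) {i : F} (hi : i ^ 2 = -1)
    {g : F} (hg : ¬IsSquare g) {d l : ℕ} (hd : d + 1 = 2 * l) {τ : F} (hτ : τ ≠ 0)
    (u : Fin d → F) (u₀ : F) :
    ∑ m : Fin d → F, ∑ m₀ : F, χ (τ * (m ⬝ᵥ m - m₀ ^ 2 / g) + (m ⬝ᵥ u + m₀ * u₀)) =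
      -((Fintype.card F : ℂ) ^ l * χ (τ⁻¹ * (-((u ⬝ᵥ u - g * u₀ ^ 2) / 4)))) := by
  have hF : ringChar F ≠ 2 := by
    intro h
    apply h2
    have := ringChar.Nat.cast_ringChar (R := F)
    rw [h] at this
    exact_mod_cast this
  have hg0 : g ≠ 0 := by rintro rfl; exact hg (IsSquare.zero)
  have hi0 : i ≠ 0 := by rintro rfl; simp at hi
  have h4 : (4 : F) ≠ 0 := by
    rw [show (4 : F) = 2 * 2 by norm_num]; exact mul_ne_zero h2 h2
  have ht : -(τ / g) ≠ 0 := neg_ne_zero.mpr (div_ne_zero hτ hg0)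
  have hG : quadSum χ (-(τ / g)) = -quadSum χ τ := by
    rw [← quadSum_mul_sq χ τ hi0, hi, eq_neg_iff_add_eq_zero, ← neg_eq_iff_add_eq_zero,
      ← quadSum_nonsquare hχ hF hg ht]
    congr 1
    field_simp
  have h1 : ∀ m : Fin d → F, ∀ m₀ : F,
      χ (τ * (m ⬝ᵥ m - m₀ ^ 2 / g) + (m ⬝ᵥ u + m₀ * u₀)) =
        χ (τ * (m ⬝ᵥ m) + m ⬝ᵥ u) * χ (-(τ / g) * m₀ ^ 2 + u₀ * m₀) := by
    intro m m₀
    rw [← AddChar.map_add_eq_mul]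
    congr 1; field_simp; ring
  simp only [h1]
  rw [← Finset.sum_mul_sum, sum_quad_linear_pi χ h2 hτ, sum_quad_linear χ h2 ht, hG]
  have hpow : quadSum χ τ ^ d * quadSum χ τ = (Fintype.card F : ℂ) ^ l := by
    rw [← pow_succ, hd, pow_mul, quadSum_sq hχ h2 hi hτ]
  have hχe : χ (-((u ⬝ᵥ u) / (4 * τ))) * χ (-(u₀ ^ 2 / (4 * -(τ / g)))) =
      χ (τ⁻¹ * (-((u ⬝ᵥ u - g * u₀ ^ 2) / 4))) := by
    rw [← AddChar.map_add_eq_mul]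
    congr 1; field_simp; ring
  rw [← hpow, ← hχe]
  ring

end GaussSums

section Isotropic

variable {F : Type*} [Field F] [Fintype F]

open Classical in
theorem sum_addChar_pi {χ : AddChar F ℂ} (hχ : χ ≠ 1) {d : ℕ} (u : Fin d → F) :
    ∑ m : Fin d → F, χ (m ⬝ᵥ u) = if u = 0 then (Fintype.card F : ℂ) ^ d else 0 := by
  have h3 := Finset.prod_univ_sum (fun _ : Fin d => (Finset.univ : Finset F))
    (fun i x => χ (x * u i))
  rw [Fintype.piFinset_univ] at h3
  simp only [dotProduct, addChar_sum_eq_prod]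
  rw [← h3]
  simp only [sum_addChar_mul hχ]
  split_ifs with hu
  · simp [hu]
  · obtain ⟨i, hi⟩ := Function.ne_iff.mp hu
    exact Finset.prod_eq_zero (Finset.mem_univ i) (if_neg hi)

open Classical in
/-- The Fourier transform of the (weighted) indicator function of the elliptic cone
`m · m = m₀² / g`. -/
theorem sum_elliptic_cone {χ : AddChar F ℂ} (hχ : χ ≠ 1) (h2 : (2 : F) ≠ 0) {i : F}
    (hi : i ^ 2 = -1) {g : F} (hg : ¬IsSquare g) {d l : ℕ} (hd : d + 1 = 2 * l)
    (u : Fin d → F) (u₀ : F) :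
    ∑ τ : F, ∑ m : Fin d → F, ∑ m₀ : F,
        χ (τ * (m ⬝ᵥ m - m₀ ^ 2 / g) + (m ⬝ᵥ u + m₀ * u₀)) =
      (if u = 0 ∧ u₀ = 0 then (Fintype.card F : ℂ) ^ (d + 1) else 0) -
        (Fintype.card F : ℂ) ^ l *
          ((if u ⬝ᵥ u - g * u₀ ^ 2 = 0 then (Fintype.card F : ℂ) else 0) - 1) := by
  have h4 : (4 : F) ≠ 0 := by
    rw [show (4 : F) = 2 * 2 by norm_num]; exact mul_ne_zero h2 h2
  rw [← Finset.add_sum_erase Finset.univ _ (Finset.mem_univ (0 : F))]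
  rw [Finset.sum_congr rfl fun τ hτ =>
    sum_elliptic hχ h2 hi hg hd (Finset.ne_of_mem_erase hτ) u u₀]
  simp only [zero_mul, zero_add]
  have hz : ∑ m : Fin d → F, ∑ m₀ : F, χ (m ⬝ᵥ u + m₀ * u₀) =
      if u = 0 ∧ u₀ = 0 then (Fintype.card F : ℂ) ^ (d + 1) else 0 := by
    simp only [AddChar.map_add_eq_mul]
    rw [← Finset.sum_mul_sum, sum_addChar_pi hχ, sum_addChar_mul hχ]
    by_cases h1 : u = 0 <;> by_cases h3 : u₀ = 0 <;> simp [h1, h3, pow_succ]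
  have hs : ∀ b : F, ∑ τ ∈ Finset.univ.erase (0 : F), χ (τ⁻¹ * b) =
      (if b = 0 then (Fintype.card F : ℂ) else 0) - 1 := by
    intro b
    have h5 := Finset.add_sum_erase Finset.univ (fun τ : F => χ (τ⁻¹ * b))
      (Finset.mem_univ (0 : F))
    have h6 : ∑ τ : F, χ (τ⁻¹ * b) = ∑ τ : F, χ (τ * b) :=
      Fintype.sum_equiv (Equiv.inv F) _ _ fun τ => by simp
    rw [h6, sum_addChar_mul hχ] at h5
    simp only [inv_zero, zero_mul, AddChar.map_zero_eq_one] at h5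
    rw [← h5]; ring
  rw [hz, Finset.sum_neg_distrib, ← Finset.mul_sum, hs, ← sub_eq_add_neg]
  simp only [neg_eq_zero, div_eq_zero_iff, h4, or_false]

open Classical in
theorem lifted_form_nonneg {χ : AddChar F ℂ} (hχ : χ ≠ 1) (h2 : (2 : F) ≠ 0) {i : F}
    (hi : i ^ 2 = -1) {g : F} (hg : ¬IsSquare g) {d l : ℕ} (hd : d + 1 = 2 * l)
    (A : Finset (F × (Fin d → F))) (c : F × (Fin d → F) → ℝ) :
    0 ≤ ∑ a ∈ A, ∑ b ∈ A, c a * c b *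
      ((if a.1 • a.2 - b.1 • b.2 = 0 ∧ a.1 - b.1 = 0 then (Fintype.card F : ℝ) ^ (d + 1) else 0) -
        (Fintype.card F : ℝ) ^ l *
          ((if (a.1 • a.2 - b.1 • b.2) ⬝ᵥ (a.1 • a.2 - b.1 • b.2) - g * (a.1 - b.1) ^ 2 = 0
            then (Fintype.card F : ℝ) else 0) - 1)) := by
  set L : F × (Fin d → F) → (Fin d → F) → F → F := fun a m m₀ => m ⬝ᵥ (a.1 • a.2) + m₀ * a.1
  set H : (Fin d → F) → F → ℂ := fun m m₀ => ∑ a ∈ A, (c a : ℂ) * χ (L a m m₀) with hH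
  have hmain : ((∑ m : Fin d → F, ∑ m₀ : F,
      (if m ⬝ᵥ m - m₀ ^ 2 / g = 0 then (Fintype.card F : ℝ) else 0) *
        Complex.normSq (H m m₀) : ℝ) : ℂ) =
      ∑ a ∈ A, ∑ b ∈ A, (c a : ℂ) * (c b : ℂ) * ∑ τ : F, ∑ m : Fin d → F, ∑ m₀ : F,
        χ (τ * (m ⬝ᵥ m - m₀ ^ 2 / g) +
          (m ⬝ᵥ (a.1 • a.2 - b.1 • b.2) + m₀ * (a.1 - b.1))) := by
    have h1 : ∀ m m₀, (((if m ⬝ᵥ m - m₀ ^ 2 / g = 0 then (Fintype.card F : ℝ) else 0) *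
        Complex.normSq (H m m₀) : ℝ) : ℂ) = ∑ a ∈ A, ∑ b ∈ A, (c a : ℂ) * (c b : ℂ) * ∑ τ : F,
        χ (τ * (m ⬝ᵥ m - m₀ ^ 2 / g) +
          (m ⬝ᵥ (a.1 • a.2 - b.1 • b.2) + m₀ * (a.1 - b.1))) := by
      intro m m₀
      rw [Complex.ofReal_mul, ← Complex.mul_conj]
      have hw : (((if m ⬝ᵥ m - m₀ ^ 2 / g = 0 then (Fintype.card F : ℝ) else 0) : ℝ) : ℂ) =
          ∑ τ : F, χ (τ * (m ⬝ᵥ m - m₀ ^ 2 / g)) := by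
        rw [sum_addChar_mul hχ]; split_ifs <;> simp
      rw [hw]
      simp only [hH, map_sum, map_mul, Complex.conj_ofReal, ← AddChar.map_neg_eq_conj]
      rw [Finset.sum_mul_sum, Finset.mul_sum]
      refine Finset.sum_congr rfl fun a _ => ?_
      rw [Finset.mul_sum]
      refine Finset.sum_congr rfl fun b _ => ?_
      have hL : m ⬝ᵥ (a.1 • a.2 - b.1 • b.2) + m₀ * (a.1 - b.1) = L a m m₀ + -L b m m₀ := by
        simp only [L, dotProduct_sub]; ring
      simp only [hL, AddChar.map_add_eq_mul, ← Finset.sum_mul]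
      ring
    push_cast [-Complex.ofReal_mul]
    simp only [h1]
    simp only [Finset.sum_comm (s := (Finset.univ : Finset F)) (t := A)]
    simp only [Finset.sum_comm (s := (Finset.univ : Finset (Fin d → F))) (t := A)]
    refine Finset.sum_congr rfl fun a _ => Finset.sum_congr rfl fun b _ => ?_
    simp only [← Finset.mul_sum]
    congr 1
    rw [Finset.sum_comm (s := (Finset.univ : Finset F))
      (t := (Finset.univ : Finset (Fin d → F)))]
    exact Finset.sum_congr rfl fun m _ => Finset.sum_comm
  have hnn : (0 : ℝ) ≤ ∑ m : Fin d → F, ∑ m₀ : F,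
      (if m ⬝ᵥ m - m₀ ^ 2 / g = 0 then (Fintype.card F : ℝ) else 0) *
        Complex.normSq (H m m₀) := by
    refine Finset.sum_nonneg fun m _ => Finset.sum_nonneg fun m₀ _ => mul_nonneg ?_
      (Complex.normSq_nonneg _)
    split_ifs <;> positivity
  refine hnn.trans_eq ?_
  rw [← Complex.ofReal_inj, hmain]
  push_cast
  refine Finset.sum_congr rfl fun a _ => Finset.sum_congr rfl fun b _ => ?_
  rw [sum_elliptic_cone hχ h2 hi hg hd]
  congr 2
  · split_ifs <;> simp
  · split_ifs <;> simp

open Classical in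
/-- Pairs of points of a sphere of non-square radius whose difference is isotropic. -/
theorem sum_isotropic_pairs_le {χ : AddChar F ℂ} (hχ : χ ≠ 1) (h2 : (2 : F) ≠ 0) {i : F}
    (hi : i ^ 2 = -1) (hq5 : 5 ≤ Fintype.card F) {g : F} (hg : ¬IsSquare g) {d l : ℕ}
    (hd : d + 1 = 2 * l) (V : Finset (Fin d → F)) (hV : ∀ x ∈ V, x ⬝ᵥ x = g)
    (h : (Fin d → F) → ℝ) :
    ∑ x ∈ V, ∑ y ∈ V, (if (x - y) ⬝ᵥ (x - y) = 0 then h x * h y else 0) ≤ pairBound V h := by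
  set q : ℝ := (Fintype.card F : ℝ) with hq
  have hq5' : (5 : ℝ) ≤ q := by rw [hq]; exact_mod_cast hq5
  set S : Finset F := Finset.univ.erase 0 with hS
  have hScard : (S.card : ℝ) = q - 1 := by
    rw [hS, Finset.card_erase_of_mem (Finset.mem_univ _), Finset.card_univ,
      Nat.cast_sub (by omega)]
    simp [hq]
  have hpos := lifted_form_nonneg hχ h2 hi hg hd (S ×ˢ V) (fun a => h a.2)
  set I := ∑ x ∈ V, ∑ y ∈ V, (if (x - y) ⬝ᵥ (x - y) = 0 then h x * h y else 0) with hI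
  have hterm : ∀ s ∈ S, ∀ t ∈ S, ∀ x ∈ V, ∀ y ∈ V,
      h x * h y * ((if s • x - t • y = 0 ∧ s - t = 0 then q ^ (d + 1) else 0) -
        q ^ l * ((if (s • x - t • y) ⬝ᵥ (s • x - t • y) - g * (s - t) ^ 2 = 0 then q else 0) - 1))
      = (if s = t then (if x = y then q ^ (d + 1) * (h x * h y) else 0) else 0) -
        (q ^ l * q * (if (x - y) ⬝ᵥ (x - y) = 0 then h x * h y else 0) -
          q ^ l * (h x * h y)) := by
    intro s hs t ht x hx y hy
    have hs0 := Finset.ne_of_mem_erase hs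
    have ht0 := Finset.ne_of_mem_erase ht
    have h1 : (s • x - t • y = 0 ∧ s - t = 0) ↔ (s = t ∧ x = y) := by
      rw [sub_eq_zero, sub_eq_zero]
      constructor
      · rintro ⟨h3, rfl⟩
        exact ⟨rfl, smul_right_injective _ hs0 h3⟩
      · rintro ⟨rfl, rfl⟩
        exact ⟨rfl, rfl⟩
    have h3 : ((s • x - t • y) ⬝ᵥ (s • x - t • y) - g * (s - t) ^ 2 = 0) ↔
        (x - y) ⬝ᵥ (x - y) = 0 := by
      have : (s • x - t • y) ⬝ᵥ (s • x - t • y) - g * (s - t) ^ 2 =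
          s * t * ((x - y) ⬝ᵥ (x - y)) := by
        simp only [sub_dotProduct, dotProduct_sub, smul_dotProduct, dotProduct_smul, smul_eq_mul,
          hV x hx, hV y hy, dotProduct_comm y x]
        ring
      rw [this, mul_eq_zero, or_iff_right (mul_ne_zero hs0 ht0)]
    simp only [h1, h3, ite_and]
    split_ifs <;> ring
  have hsum : ∑ a ∈ S ×ˢ V, ∑ b ∈ S ×ˢ V, h a.2 * h b.2 *
      ((if a.1 • a.2 - b.1 • b.2 = 0 ∧ a.1 - b.1 = 0 then q ^ (d + 1) else 0) -
        q ^ l * ((if (a.1 • a.2 - b.1 • b.2) ⬝ᵥ (a.1 • a.2 - b.1 • b.2) - g * (a.1 - b.1) ^ 2 = 0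
            then q else 0) - 1)) =
      (q - 1) * (q ^ (d + 1) * ∑ x ∈ V, h x ^ 2) -
        (q - 1) ^ 2 * (q ^ l * q * I - q ^ l * (∑ x ∈ V, h x) ^ 2) := by
    simp only [Finset.sum_product]
    have h5 : ∀ s ∈ S, ∀ x ∈ V, (∑ t ∈ S, ∑ y ∈ V,
        h x * h y * ((if s • x - t • y = 0 ∧ s - t = 0 then q ^ (d + 1) else 0) - q ^ l *
          ((if (s • x - t • y) ⬝ᵥ (s • x - t • y) - g * (s - t) ^ 2 = 0 then q else 0) - 1))) =
        q ^ (d + 1) * h x ^ 2 - (q - 1) * (q ^ l * q * (∑ y ∈ V,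
          if (x - y) ⬝ᵥ (x - y) = 0 then h x * h y else 0) - q ^ l * (h x * ∑ y ∈ V, h y)) := by
      intro s hs x hx
      rw [Finset.sum_congr rfl fun t ht => Finset.sum_congr rfl fun y hy =>
        hterm s hs t ht x hx y hy]
      simp only [Finset.sum_sub_distrib, Finset.sum_const, nsmul_eq_mul, hScard,
        ← Finset.mul_sum]
      have : ∑ t ∈ S, ∑ y ∈ V, (if s = t then
          (if x = y then q ^ (d + 1) * (h x * h y) else 0) else 0) = q ^ (d + 1) * h x ^ 2 := by
        rw [Finset.sum_eq_single s]
        · simp [hx, sq]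
        · intro t _ hts; simp [hts.symm]
        · intro hs'; exact absurd hs hs'
      rw [this]; ring
    rw [Finset.sum_congr rfl fun s hs => Finset.sum_congr rfl fun x hx => h5 s hs x hx]
    simp only [Finset.sum_sub_distrib, Finset.sum_const, nsmul_eq_mul, hScard,
        ← Finset.mul_sum, ← Finset.sum_mul]
    rw [← hI]
    ring
  rw [hsum] at hpos
  set B := ∑ x ∈ V, h x ^ 2 with hB
  set N := ∑ x ∈ V, h x with hN
  have hB0 : 0 ≤ B := Finset.sum_nonneg fun x _ => sq_nonneg _
  have hql : 0 < q ^ l := by positivity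
  have hq1 : 0 < q - 1 := by linarith
  have h7 : (q - 1) * (q * I - N ^ 2) ≤ q ^ l * B := by
    have h8 : (q - 1) * q ^ l * ((q - 1) * (q * I - N ^ 2)) ≤ (q - 1) * q ^ l * (q ^ l * B) := by
      have h9 : q ^ (d + 1) = q ^ l * q ^ l := by rw [hd, two_mul, pow_add]
      rw [h9] at hpos
      linarith
    exact le_of_mul_le_mul_left h8 (by positivity)
  have hsqrt : q ^ l ≤ (q - 1) * √(q ^ d) := by
    have h10 : q ^ l = √q * √(q ^ d) := by
      rw [← Real.sqrt_mul (by positivity), ← pow_succ', hd, mul_comm, pow_mul, Real.sqrt_sq hql.le]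
    rw [h10]
    gcongr
    rw [Real.sqrt_le_left hq1.le]
    nlinarith
  have h11 : q * I - N ^ 2 ≤ √(q ^ d) * B := by
    have : (q - 1) * (q * I - N ^ 2) ≤ (q - 1) * (√(q ^ d) * B) := by
      refine h7.trans ?_
      rw [← mul_assoc]
      gcongr
    exact le_of_mul_le_mul_left this hq1
  have h12 : I = q⁻¹ * (q * I) := by
    rw [← mul_assoc, inv_mul_cancel₀ (by positivity), one_mul]
  rw [h12, pairBound, mul_assoc, ← mul_add]
  gcongr
  linarith

end Isotropic

section Energy

/-- A sum over quadruples subject to a symmetric relation `ρ` that determines the fourth entry is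
bounded by a sum over triples. -/
theorem sum_quadruple_le {α : Type*} (V : Finset α) (ρ : α → α → α → α → Prop)
    [∀ a b c e, Decidable (ρ a b c e)] (σ : α → α → α → Prop) [∀ a b c, Decidable (σ a b c)]
    (f h k : α → ℝ) (hh : ∀ x, 0 ≤ h x) (hk : ∀ x, 0 ≤ k x)
    (hf : ∀ a b c e, f a * f b * f c * f e ≤
      (h a * h b * (k c + k e) + h c * h e * (k a + k b)) / 4)
    (hswap : ∀ a b c e, ρ a b c e ↔ ρ b a e c) (hflip : ∀ a b c e, ρ a b c e ↔ ρ c e a b)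
    (hdet : ∀ a b c e e', ρ a b c e → ρ a b c e' → e = e')
    (hσ : ∀ a ∈ V, ∀ b ∈ V, ∀ c ∈ V, ∀ e ∈ V, ρ a b c e → σ a b c) :
    ∑ a ∈ V, ∑ b ∈ V, ∑ c ∈ V, ∑ e ∈ V, (if ρ a b c e then f a * f b * f c * f e else 0) ≤
      ∑ c ∈ V, k c * ∑ a ∈ V, ∑ b ∈ V, (if σ a b c then h a * h b else 0) := by
  set T : ℝ := ∑ a ∈ V, ∑ b ∈ V, ∑ c ∈ V, ∑ e ∈ V,
    (if ρ a b c e then h a * h b * k c else 0) with hT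
  have h1 : ∑ a ∈ V, ∑ b ∈ V, ∑ c ∈ V, ∑ e ∈ V,
      (if ρ a b c e then h a * h b * k e else 0) = T := by
    rw [Finset.sum_comm, hT]
    refine Finset.sum_congr rfl fun b _ => Finset.sum_congr rfl fun a _ => ?_
    rw [Finset.sum_comm]
    refine Finset.sum_congr rfl fun e _ => Finset.sum_congr rfl fun c _ => ?_
    simp only [hswap a b c e, mul_comm (h a)]
  have hflipsum : ∀ G : α → α → α → α → ℝ,
      ∑ a ∈ V, ∑ b ∈ V, ∑ c ∈ V, ∑ e ∈ V, (if ρ a b c e then G c e a b else 0) =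
      ∑ a ∈ V, ∑ b ∈ V, ∑ c ∈ V, ∑ e ∈ V, (if ρ a b c e then G a b c e else 0) := by
    intro G
    calc _ = ∑ a ∈ V, ∑ c ∈ V, ∑ b ∈ V, ∑ e ∈ V, (if ρ a b c e then G c e a b else 0) :=
          Finset.sum_congr rfl fun a _ => Finset.sum_comm
      _ = ∑ c ∈ V, ∑ a ∈ V, ∑ e ∈ V, ∑ b ∈ V, (if ρ a b c e then G c e a b else 0) := by
          rw [Finset.sum_comm]
          exact Finset.sum_congr rfl fun c _ => Finset.sum_congr rfl fun a _ => Finset.sum_comm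
      _ = ∑ c ∈ V, ∑ e ∈ V, ∑ a ∈ V, ∑ b ∈ V, (if ρ c e a b then G c e a b else 0) := by
          refine Finset.sum_congr rfl fun c _ => ?_
          rw [Finset.sum_comm]
          refine Finset.sum_congr rfl fun e _ => Finset.sum_congr rfl fun a _ =>
            Finset.sum_congr rfl fun b _ => ?_
          simp only [hflip a b c e]
  have h2 : ∑ a ∈ V, ∑ b ∈ V, ∑ c ∈ V, ∑ e ∈ V,
      (if ρ a b c e then h c * h e * k a else 0) = T := hflipsum fun a b c _ => h a * h b * k c
  have h3 : ∑ a ∈ V, ∑ b ∈ V, ∑ c ∈ V, ∑ e ∈ V,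
      (if ρ a b c e then h c * h e * k b else 0) = T :=
    (hflipsum fun a b _ e => h a * h b * k e).trans h1
  have h4 : ∑ a ∈ V, ∑ b ∈ V, ∑ c ∈ V, ∑ e ∈ V,
      (if ρ a b c e then f a * f b * f c * f e else 0) ≤ T := by
    calc _ ≤ ∑ a ∈ V, ∑ b ∈ V, ∑ c ∈ V, ∑ e ∈ V,
          (((if ρ a b c e then h a * h b * k c else 0) +
            (if ρ a b c e then h a * h b * k e else 0) +
            (if ρ a b c e then h c * h e * k a else 0) +
            (if ρ a b c e then h c * h e * k b else 0)) / 4) := by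
          refine Finset.sum_le_sum fun a _ => Finset.sum_le_sum fun b _ =>
            Finset.sum_le_sum fun c _ => Finset.sum_le_sum fun e _ => ?_
          split_ifs
          · linarith [hf a b c e]
          · simp
      _ = (T + T + T + T) / 4 := by
          simp only [Finset.sum_add_distrib, ← Finset.sum_div]
          rw [h1, h2, h3]
      _ = T := by ring
  refine h4.trans ?_
  have h5 : ∑ c ∈ V, k c * ∑ a ∈ V, ∑ b ∈ V, (if σ a b c then h a * h b else 0) =
      ∑ a ∈ V, ∑ b ∈ V, ∑ c ∈ V, (if σ a b c then h a * h b * k c else 0) := by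
    simp only [Finset.mul_sum]
    rw [Finset.sum_comm]
    refine Finset.sum_congr rfl fun a _ => ?_
    rw [Finset.sum_comm]
    refine Finset.sum_congr rfl fun b _ => Finset.sum_congr rfl fun c _ => ?_
    split_ifs <;> ring
  rw [h5]
  refine Finset.sum_le_sum fun a ha => Finset.sum_le_sum fun b hb =>
    Finset.sum_le_sum fun c hc => ?_
  have hnn : 0 ≤ h a * h b * k c := mul_nonneg (mul_nonneg (hh a) (hh b)) (hk c)
  by_cases hex : ∃ e ∈ V, ρ a b c e
  · obtain ⟨e, he, hρ⟩ := hex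
    rw [Finset.sum_eq_single e, if_pos hρ, if_pos (hσ a ha b hb c hc e he hρ)]
    · intro e' _ hne
      exact if_neg fun hρ' => hne (hdet a b c e' e hρ' hρ)
    · intro h; exact absurd he h
  · push Not at hex
    rw [Finset.sum_eq_zero fun e he => if_neg (hex e he)]
    split_ifs
    · exact hnn
    · exact le_rfl

variable {F : Type*} [Field F] {d : ℕ}

open Classical in
/-- The weighted additive energy of `f` on `V`. -/
def energy (V : Finset (Fin d → F)) (f : (Fin d → F) → ℝ) : ℝ :=
  ∑ x ∈ V, ∑ y ∈ V, ∑ z ∈ V, ∑ w ∈ V, if x + y = z + w then f x * f y * f z * f w else 0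

open Classical in
theorem energy_le_sum_pow (V : Finset (Fin d → F)) (f h : (Fin d → F) → ℝ)
    (hh : ∀ x, 0 ≤ h x)
    (hf : ∀ a b c e, f a * f b * f c * f e ≤
      (h a * h b * (h c + h e) + h c * h e * (h a + h b)) / 4) :
    energy V f ≤ (∑ x ∈ V, h x) ^ 3 := by
  have := sum_quadruple_le V (fun x y z w => x + y = z + w) (fun _ _ _ => True) f h h hh hh hf
    (fun a b c e => by rw [add_comm a b, add_comm c e]) (fun a b c e => eq_comm)
    (fun a b c e e' h1 h2 => add_left_cancel (h1.symm.trans h2))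
    (fun _ _ _ _ _ _ _ _ _ => trivial)
  refine this.trans (le_of_eq ?_)
  simp only [if_true, ← Finset.sum_mul, ← Finset.mul_sum]
  ring

theorem ite_le_of_cover {p a b : Prop} [Decidable p] [Decidable a] [Decidable b] {t : ℝ} (ht : 0 ≤ t) :
    (if p then t else 0) ≤ (if p ∧ ¬a ∧ ¬b then t else 0) + (if p ∧ a then t else 0) +
      (if p ∧ b then t else 0) := by
  by_cases hp : p <;> by_cases ha : a <;> by_cases hb : b <;> simp [hp, ha, hb, ht]

/-- The energy bound on a sphere of primitive radius. -/
theorem energy_le [Fintype F] {χ : AddChar F ℂ} (hχ : χ ≠ 1) (h2 : (2 : F) ≠ 0) {i : F}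
    (hi : i ^ 2 = -1) (hq5 : 5 ≤ Fintype.card F) {g : F} (hg : ¬IsSquare g) {l : ℕ}
    (hd : d + 1 = 2 * l) (V : Finset (Fin d → F)) (hV : ∀ x ∈ V, x ⬝ᵥ x = g)
    (f h k : (Fin d → F) → ℝ) (hf0 : ∀ x, 0 ≤ f x) (hh : ∀ x, 0 ≤ h x) (hk : ∀ x, 0 ≤ k x)
    (hf : ∀ a b c e, f a * f b * f c * f e ≤
      (h a * h b * (k c + k e) + h c * h e * (k a + k b)) / 4) :
    energy V f ≤ 3 * ((∑ x ∈ V, k x) * pairBound V h) := by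
  classical
  have hg0 : g ≠ 0 := by rintro rfl; exact hg (IsSquare.zero)
  have hrev : ∀ x y : Fin d → F, (x - y) ⬝ᵥ (x - y) = (y - x) ⬝ᵥ (y - x) := by
    intro x y
    rw [← neg_sub y x, neg_dotProduct_neg]
  obtain ⟨ρ₁, hρ₁⟩ : ∃ ρ : (Fin d → F) → (Fin d → F) → (Fin d → F) → (Fin d → F) → Prop,
    ∀ x y z w, ρ x y z w ↔
      (x + y = z + w ∧ (x - z) ⬝ᵥ (x - z) ≠ 0 ∧ (y - z) ⬝ᵥ (y - z) ≠ 0) :=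
    ⟨_, fun _ _ _ _ => Iff.rfl⟩
  obtain ⟨ρ₂, hρ₂⟩ : ∃ ρ : (Fin d → F) → (Fin d → F) → (Fin d → F) → (Fin d → F) → Prop,
    ∀ x z y w, ρ x z y w ↔ (x + y = z + w ∧ (x - z) ⬝ᵥ (x - z) = 0) :=
    ⟨_, fun _ _ _ _ => Iff.rfl⟩
  have hnon := sum_quadruple_le V ρ₁ (fun x y z => (x - z) ⬝ᵥ (x - z) ≠ 0 ∧
      (y - z) ⬝ᵥ (y - z) ≠ 0 ∧ (x - z) ⬝ᵥ (y - z) = 0) f h k hh hk hf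
    (by
      intro a b c e
      simp only [hρ₁]
      rw [add_comm b a, add_comm e c]
      refine and_congr_right fun heq => ?_
      have h5 : b - e = c - a := by rw [sub_eq_sub_iff_add_eq_add, add_comm b a, heq]
      have h6 : a - e = c - b := by rw [sub_eq_sub_iff_add_eq_add, heq]
      rw [h5, h6, hrev a c, hrev b c])
    (by
      intro a b c e
      simp only [hρ₁]
      rw [eq_comm]
      refine and_congr_right fun heq => ?_
      have h6 : e - a = b - c := by
        rw [sub_eq_sub_iff_add_eq_add, add_comm e c, heq, add_comm]
      rw [h6, hrev c a])
    (fun a b c e e' h3 h4 => add_left_cancel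
      (((hρ₁ _ _ _ _).mp h3).1.symm.trans ((hρ₁ _ _ _ _).mp h4).1))
    (by
      intro a ha b hb c hc e he hρ
      rw [hρ₁] at hρ
      refine ⟨hρ.2.1, hρ.2.2, ?_⟩
      have he' : e = a + b - c := by rw [hρ.1, add_sub_cancel_left]
      have h7 := hV e he
      rw [he'] at h7
      have h8 : (2 : F) * ((a - c) ⬝ᵥ (b - c)) = (a + b - c) ⬝ᵥ (a + b - c) - g := by
        simp only [sub_dotProduct, dotProduct_sub, add_dotProduct, dotProduct_add, hV a ha,
          hV b hb, hV c hc, dotProduct_comm b a, dotProduct_comm c a, dotProduct_comm c b]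
        ring
      rw [h7, sub_self] at h8
      exact (mul_eq_zero.mp h8).resolve_left h2)
  have hiso := sum_quadruple_le V ρ₂ (fun x z _ => (x - z) ⬝ᵥ (x - z) = 0) f h k hh hk hf
    (by
      intro a b c e
      simp only [hρ₂]
      rw [hrev a b, eq_comm (a := a + c)])
    (by
      intro a b c e
      simp only [hρ₂]
      rw [add_comm c a, add_comm e b]
      refine and_congr_right fun heq => ?_
      have h6 : c - e = b - a := by
        rw [sub_eq_sub_iff_add_eq_add, add_comm c a, heq]
      rw [h6, hrev a b])
    (fun a b c e e' h3 h4 => add_left_cancel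
      (((hρ₂ _ _ _ _).mp h3).1.symm.trans ((hρ₂ _ _ _ _).mp h4).1))
    (fun a _ b _ c _ e _ hρ => ((hρ₂ _ _ _ _).mp hρ).2)
  have hnon' := hnon.trans (Finset.sum_le_sum fun z hz => mul_le_mul_of_nonneg_left
    (sum_orthogonal_chords_le h2 hg0 (hV z hz) V hV h hh) (hk z))
  have hiso' := hiso.trans (Finset.sum_le_sum fun z hz => mul_le_mul_of_nonneg_left
    (sum_isotropic_pairs_le hχ h2 hi hq5 hg hd V hV h) (hk z))
  rw [← Finset.sum_mul] at hnon' hiso'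
  have hi1 : ∑ x ∈ V, ∑ y ∈ V, ∑ z ∈ V, ∑ w ∈ V,
      (if ρ₂ x z y w then f x * f z * f y * f w else 0) =
      ∑ x ∈ V, ∑ y ∈ V, ∑ z ∈ V, ∑ w ∈ V,
      (if ρ₂ x y z w then f x * f y * f z * f w else 0) :=
    Finset.sum_congr rfl fun x _ => Finset.sum_comm
  have hi2 : ∑ x ∈ V, ∑ y ∈ V, ∑ z ∈ V, ∑ w ∈ V,
      (if ρ₂ y z x w then f y * f z * f x * f w else 0) =
      ∑ x ∈ V, ∑ y ∈ V, ∑ z ∈ V, ∑ w ∈ V,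
      (if ρ₂ x y z w then f x * f y * f z * f w else 0) := by
    rw [Finset.sum_comm]
    exact Finset.sum_congr rfl fun x _ => Finset.sum_comm
  have hsplit : energy V f ≤
      ∑ x ∈ V, ∑ y ∈ V, ∑ z ∈ V, ∑ w ∈ V,
        (if ρ₁ x y z w then f x * f y * f z * f w else 0) +
      ∑ x ∈ V, ∑ y ∈ V, ∑ z ∈ V, ∑ w ∈ V,
        (if ρ₂ x z y w then f x * f z * f y * f w else 0) +
      ∑ x ∈ V, ∑ y ∈ V, ∑ z ∈ V, ∑ w ∈ V,
        (if ρ₂ y z x w then f y * f z * f x * f w else 0) := by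
    rw [energy]
    simp only [← Finset.sum_add_distrib]
    refine Finset.sum_le_sum fun x _ => Finset.sum_le_sum fun y _ =>
      Finset.sum_le_sum fun z _ => Finset.sum_le_sum fun w _ => ?_
    have hp : 0 ≤ f x * f y * f z * f w :=
      mul_nonneg (mul_nonneg (mul_nonneg (hf0 x) (hf0 y)) (hf0 z)) (hf0 w)
    simp only [hρ₁, hρ₂, add_comm y x, mul_right_comm (f x) (f z) (f y),
      show f y * f z * f x * f w = f x * f y * f z * f w by ring]
    exact ite_le_of_cover hp
  rw [hi1, hi2] at hsplit
  refine hsplit.trans ?_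
  rw [add_assoc, show ∀ t : ℝ, 3 * t = t + (t + t) by intro t; ring]
  exact add_le_add hnon' (add_le_add hiso' hiso')

end Energy

section FourthMoment

variable {F : Type*} [Field F] [Fintype F] {d : ℕ}

theorem sum_norm_pow_four_le {χ : AddChar F ℂ} (hχ : χ ≠ 1) (V : Finset (Fin d → F))
    (a : (Fin d → F) → ℂ) :
    ∑ m : Fin d → F, ‖∑ x ∈ V, χ (m ⬝ᵥ x) * a x‖ ^ 4 ≤
      (Fintype.card F : ℝ) ^ d * energy V (fun x => ‖a x‖) := by
  classical
  have h1 : ∀ m : Fin d → F, ((‖∑ x ∈ V, χ (m ⬝ᵥ x) * a x‖ ^ 4 : ℝ) : ℂ) =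
      ∑ x ∈ V, ∑ y ∈ V, ∑ z ∈ V, ∑ w ∈ V, a x * a y * (starRingEnd ℂ) (a z) *
        (starRingEnd ℂ) (a w) * χ (m ⬝ᵥ (x + y - (z + w))) := by
    intro m
    set S := ∑ x ∈ V, χ (m ⬝ᵥ x) * a x with hS
    have h2 : ((‖S‖ ^ 4 : ℝ) : ℂ) = S * S * ((starRingEnd ℂ) S * (starRingEnd ℂ) S) := by
      rw [show ‖S‖ ^ 4 = (‖S‖ ^ 2) ^ 2 by ring, Complex.ofReal_pow, Complex.ofReal_pow,
        ← Complex.mul_conj']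
      ring
    have h3 : (starRingEnd ℂ) S = ∑ x ∈ V, χ (-(m ⬝ᵥ x)) * (starRingEnd ℂ) (a x) := by
      simp only [hS, map_sum, map_mul, AddChar.map_neg_eq_conj]
    rw [h2, h3, hS, Finset.sum_mul_sum, Finset.sum_mul_sum]
    simp only [Finset.sum_mul]
    simp only [Finset.mul_sum]
    refine Finset.sum_congr rfl fun x _ => Finset.sum_congr rfl fun y _ =>
      Finset.sum_congr rfl fun z _ => Finset.sum_congr rfl fun w _ => ?_
    have h4 : m ⬝ᵥ (x + y - (z + w)) = m ⬝ᵥ x + m ⬝ᵥ y + (-(m ⬝ᵥ z) + -(m ⬝ᵥ w)) := by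
      simp only [dotProduct_sub, dotProduct_add]; ring
    rw [h4, AddChar.map_add_eq_mul, AddChar.map_add_eq_mul, AddChar.map_add_eq_mul]
    ring
  have h5 : ((∑ m : Fin d → F, ‖∑ x ∈ V, χ (m ⬝ᵥ x) * a x‖ ^ 4 : ℝ) : ℂ) =
      ∑ x ∈ V, ∑ y ∈ V, ∑ z ∈ V, ∑ w ∈ V, a x * a y * (starRingEnd ℂ) (a z) *
        (starRingEnd ℂ) (a w) * (if x + y = z + w then (Fintype.card F : ℂ) ^ d else 0) := by
    rw [Complex.ofReal_sum]
    simp only [h1]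
    simp only [Finset.sum_comm (s := (Finset.univ : Finset (Fin d → F))) (t := V)]
    simp only [← Finset.mul_sum, sum_addChar_pi hχ, sub_eq_zero]
  have h6 : ∑ m : Fin d → F, ‖∑ x ∈ V, χ (m ⬝ᵥ x) * a x‖ ^ 4 =
      ‖((∑ m : Fin d → F, ‖∑ x ∈ V, χ (m ⬝ᵥ x) * a x‖ ^ 4 : ℝ) : ℂ)‖ := by
    rw [Complex.norm_real, Real.norm_of_nonneg]
    exact Finset.sum_nonneg fun m _ => by positivity
  rw [h6, h5, energy]
  simp only [Finset.mul_sum]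
  refine (norm_sum_le _ _).trans (Finset.sum_le_sum fun x _ => ?_)
  refine (norm_sum_le _ _).trans (Finset.sum_le_sum fun y _ => ?_)
  refine (norm_sum_le _ _).trans (Finset.sum_le_sum fun z _ => ?_)
  refine (norm_sum_le _ _).trans (Finset.sum_le_sum fun w _ => ?_)
  simp only [norm_mul, RCLike.norm_conj]
  split_ifs
  · simp only [norm_pow, Complex.norm_natCast]
    exact le_of_eq (by ring)
  · simp

theorem mem_sphere {j : F} {x : Fin d → F} : x ∈ sphere d j ↔ x ⬝ᵥ x = j := by
  simp [sphere, dotProduct, sq]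

/-- A lower bound for the size of spheres in dimension `n + 2` when `-1` is a square. -/
theorem le_card_sphere (h2 : (2 : F) ≠ 0) {i : F} (hi : i ^ 2 = -1) (g : F) (n : ℕ) :
    (Fintype.card F - 1) * Fintype.card F ^ n ≤ (sphere (n + 2) g).card := by
  classical
  have hi0 : i ≠ 0 := by rintro rfl; simp at hi
  let c : (Fin n → F) → F := fun y => g - y ⬝ᵥ y
  let φ : Fˣ × (Fin n → F) → (Fin (n + 2) → F) := fun p =>
    Fin.cons ((p.1 + c p.2 / p.1) / 2) (Fin.cons ((p.1 - c p.2 / p.1) / (2 * i)) p.2)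
  have hcard : (Finset.univ : Finset (Fˣ × (Fin n → F))).card =
      (Fintype.card F - 1) * Fintype.card F ^ n := by
    rw [Finset.card_univ, Fintype.card_prod, Fintype.card_units, Fintype.card_fun,
      Fintype.card_fin]
  rw [← hcard]
  refine Finset.card_le_card_of_injOn φ ?_ ?_
  · intro p _
    have hu : (p.1 : F) ≠ 0 := p.1.ne_zero
    simp only [Finset.mem_coe, mem_sphere, φ, dotProduct, Fin.sum_univ_succ, Fin.cons_zero,
      Fin.cons_succ]
    have hc : c p.2 = g - ∑ j, p.2 j * p.2 j := rfl
    have hg : g = c p.2 + ∑ j, p.2 j * p.2 j := by rw [hc]; ring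
    rw [← add_assoc, ← eq_sub_iff_add_eq, ← hc, ← sq, ← sq, div_pow, div_pow, mul_pow, hi]
    field_simp
    ring
  · rintro ⟨u, y⟩ _ ⟨u', y'⟩ _ h
    obtain ⟨h3, h4⟩ := Fin.cons_injective2 h
    obtain ⟨h5, h6⟩ := Fin.cons_injective2 h4
    have key : ∀ (u : F) (b : F), (u + b) / 2 + i * ((u - b) / (2 * i)) = u := by
      intro u b; field_simp; ring
    have h7 : (u : F) = u' := by
      simp only at h3 h5
      rw [← key u (c y / u), h3, h5, key]
    exact Prod.ext (Units.ext h7) h6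

end FourthMoment

section Truncation

theorem mul_four_le_pow_four (a b c e : ℝ) :
    a * b * c * e ≤ (a ^ 4 + b ^ 4 + c ^ 4 + e ^ 4) / 4 := by
  nlinarith [sq_nonneg (a * b - c * e), sq_nonneg (a ^ 2 - b ^ 2), sq_nonneg (c ^ 2 - e ^ 2)]

theorem mul_four_le_rpow {a b c e : ℝ} (ha : 0 ≤ a) (hb : 0 ≤ b) (hc : 0 ≤ c) (he : 0 ≤ e) :
    a * b * c * e ≤ (a ^ (4 / 3 : ℝ) * b ^ (4 / 3 : ℝ) * (c ^ (4 / 3 : ℝ) + e ^ (4 / 3 : ℝ)) +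
      c ^ (4 / 3 : ℝ) * e ^ (4 / 3 : ℝ) * (a ^ (4 / 3 : ℝ) + b ^ (4 / 3 : ℝ))) / 4 := by
  have h3 : ∀ x : ℝ, 0 ≤ x → (x ^ (1 / 3 : ℝ)) ^ 3 = x := fun x hx => by
    rw [← Real.rpow_natCast, ← Real.rpow_mul hx]; norm_num
  have h4 : ∀ x : ℝ, 0 ≤ x → x ^ (4 / 3 : ℝ) = (x ^ (1 / 3 : ℝ)) ^ 4 := fun x hx => by
    rw [← Real.rpow_natCast, ← Real.rpow_mul hx]; norm_num
  rw [h4 a ha, h4 b hb, h4 c hc, h4 e he]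
  nth_rewrite 1 [← h3 a ha, ← h3 b hb, ← h3 c hc, ← h3 e he]
  generalize a ^ (1 / 3 : ℝ) = u
  generalize b ^ (1 / 3 : ℝ) = v
  generalize c ^ (1 / 3 : ℝ) = w
  generalize e ^ (1 / 3 : ℝ) = z
  have := mul_four_le_pow_four (u * v * w) (u * v * z) (w * z * u) (w * z * v)
  linarith

theorem mul_four_le_sq (a b c e : ℝ) (ha : 0 ≤ a) (hb : 0 ≤ b) (hc : 0 ≤ c) (he : 0 ≤ e) :
    a * b * c * e ≤ (a * b * (c ^ 2 + e ^ 2) + c * e * (a ^ 2 + b ^ 2)) / 4 := by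
  have h1 : 0 ≤ a * b * (c - e) ^ 2 := by positivity
  have h2 : 0 ≤ c * e * (a - b) ^ 2 := by positivity
  linarith

variable {α : Type*} (V : Finset α) (f : α → ℝ) {p r t : ℝ}

theorem sum_rpow_le_of_forall_le (hf : ∀ x, 0 ≤ f x) (hp : 0 < p) (hr : p ≤ r)
    (ht : ∀ x, f x ≤ t) (hsum : ∑ x ∈ V, f x ^ p ≤ 1) (ht0 : 0 ≤ t) :
    ∑ x ∈ V, f x ^ r ≤ t ^ (r - p) := by
  calc ∑ x ∈ V, f x ^ r ≤ ∑ x ∈ V, f x ^ p * t ^ (r - p) := by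
        refine Finset.sum_le_sum fun x _ => ?_
        have : f x ^ r = f x ^ p * f x ^ (r - p) := by
          rw [← Real.rpow_add_of_nonneg (hf x) hp.le (by linarith)]; congr 1; ring
        rw [this]
        exact mul_le_mul_of_nonneg_left
          (Real.rpow_le_rpow (hf x) (ht x) (by linarith)) (Real.rpow_nonneg (hf x) _)
    _ = (∑ x ∈ V, f x ^ p) * t ^ (r - p) := by rw [Finset.sum_mul]
    _ ≤ 1 * t ^ (r - p) := by gcongr
    _ = _ := one_mul _

theorem sum_rpow_le_of_eq_zero_or_le (hf : ∀ x, 0 ≤ f x) (hr0 : 0 < r) (hr : r ≤ p)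
    (ht : ∀ x, f x = 0 ∨ t ≤ f x) (hsum : ∑ x ∈ V, f x ^ p ≤ 1) (ht0 : 0 < t) :
    ∑ x ∈ V, f x ^ r ≤ t ^ (r - p) := by
  calc ∑ x ∈ V, f x ^ r ≤ ∑ x ∈ V, f x ^ p * t ^ (r - p) := by
        refine Finset.sum_le_sum fun x _ => ?_
        rcases ht x with h0 | h0
        · rw [h0, Real.zero_rpow hr0.ne', Real.zero_rpow (hr0.trans_le hr).ne', zero_mul]
        · have hx : 0 < f x := ht0.trans_le h0
          have : f x ^ r = f x ^ p * f x ^ (r - p) := by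
            rw [← Real.rpow_add hx]; congr 1; ring
          rw [this]
          exact mul_le_mul_of_nonneg_left
            (Real.rpow_le_rpow_of_nonpos ht0 h0 (by linarith)) (Real.rpow_nonneg (hf x) _)
    _ = (∑ x ∈ V, f x ^ p) * t ^ (r - p) := by rw [Finset.sum_mul]
    _ ≤ 1 * t ^ (r - p) := by gcongr
    _ = _ := one_mul _

theorem sum_rpow_le_card (hf : ∀ x, 0 ≤ f x) (hr0 : 0 < r) (hr : r ≤ p)
    (hsum : ∑ x ∈ V, f x ^ p ≤ 1) (hV : 0 < V.card) :
    ∑ x ∈ V, f x ^ r ≤ 2 * (V.card : ℝ) ^ (1 - r / p) := by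
  have hp : 0 < p := hr0.trans_le hr
  have hN : (0 : ℝ) < V.card := by exact_mod_cast hV
  set t : ℝ := (V.card : ℝ) ^ (-(1 / p)) with ht
  have ht0 : 0 < t := Real.rpow_pos_of_pos hN _
  have h1 : t ^ (r - p) = (V.card : ℝ) ^ (1 - r / p) := by
    rw [ht, ← Real.rpow_mul hN.le]; congr 1; field_simp; ring
  have h2 : (V.card : ℝ) * t ^ r = (V.card : ℝ) ^ (1 - r / p) := by
    rw [ht, ← Real.rpow_mul hN.le]
    nth_rewrite 1 [← Real.rpow_one (V.card : ℝ)]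
    rw [← Real.rpow_add hN]; congr 1; field_simp; ring
  calc ∑ x ∈ V, f x ^ r ≤ ∑ x ∈ V, (f x ^ p * t ^ (r - p) + t ^ r) := by
        refine Finset.sum_le_sum fun x _ => ?_
        rcases le_total (f x) t with h | h
        · have := Real.rpow_le_rpow (hf x) h hr0.le
          have h3 : 0 ≤ f x ^ p * t ^ (r - p) :=
            mul_nonneg (Real.rpow_nonneg (hf x) _) (Real.rpow_nonneg ht0.le _)
          linarith
        · have hx : 0 < f x := ht0.trans_le h
          have h3 : f x ^ r = f x ^ p * f x ^ (r - p) := by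
            rw [← Real.rpow_add hx]; congr 1; ring
          have h4 : f x ^ p * f x ^ (r - p) ≤ f x ^ p * t ^ (r - p) :=
            mul_le_mul_of_nonneg_left
              (Real.rpow_le_rpow_of_nonpos ht0 h (by linarith)) (Real.rpow_nonneg (hf x) _)
          have h5 : 0 ≤ t ^ r := Real.rpow_nonneg ht0.le _
          linarith
    _ = (∑ x ∈ V, f x ^ p) * t ^ (r - p) + V.card * t ^ r := by
        rw [Finset.sum_add_distrib, Finset.sum_mul]; simp
    _ ≤ 1 * t ^ (r - p) + V.card * t ^ r := by gcongr
    _ = _ := by rw [h1, h2]; ring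

end Truncation

section Exponents

/-- The exponent `4d / (3d - 2)`. -/
def extExp (d : ℕ) : ℝ := 4 * (d : ℝ) / (3 * (d : ℝ) - 2)

variable {d : ℕ} {q N : ℝ}

theorem extExp_inv (hd : 3 ≤ d) : 1 / extExp d = (3 - 2 / (d : ℝ)) / 4 := by
  have h : (3 : ℝ) ≤ d := by exact_mod_cast hd
  have h' : 3 * (d : ℝ) - 2 ≠ 0 := by linarith
  unfold extExp
  field_simp

theorem extExp_bounds (hd : 3 ≤ d) : 4 / 3 ≤ extExp d ∧ extExp d ≤ 2 := by
  have h : (3 : ℝ) ≤ d := by exact_mod_cast hd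
  have h' : 0 < 3 * (d : ℝ) - 2 := by linarith
  unfold extExp
  constructor
  · rw [div_le_div_iff₀ (by norm_num) h']; linarith
  · rw [div_le_iff₀ h']; linarith

theorem rpow_le_size (hd : 3 ≤ d) (hq : 5 ≤ q) (hN : q ^ d ≤ 2 * q * N) :
    q ^ (1 - 2 / (d : ℝ)) ≤ 2 * (N ^ (2 / (d : ℝ)) / q) := by
  have h : (3 : ℝ) ≤ d := by exact_mod_cast hd
  have hq0 : 0 < q := by linarith
  have hN2 : q ^ ((d : ℝ) - 1) / 2 ≤ N := by
    rw [Real.rpow_sub hq0, Real.rpow_natCast, Real.rpow_one, div_div, div_le_iff₀ (by linarith)]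
    linarith
  have h1 : (q ^ ((d : ℝ) - 1) / 2) ^ (2 / (d : ℝ)) ≤ N ^ (2 / (d : ℝ)) :=
    Real.rpow_le_rpow (by positivity) hN2 (by positivity)
  rw [Real.div_rpow (by positivity) (by norm_num), ← Real.rpow_mul hq0.le] at h1
  have h2 : (2 : ℝ) ^ (2 / (d : ℝ)) ≤ 2 := by
    nth_rewrite 3 [← Real.rpow_one (2 : ℝ)]
    refine Real.rpow_le_rpow_of_exponent_le (by norm_num) ?_
    rw [div_le_one (by linarith)]; linarith
  have h3 : ((d : ℝ) - 1) * (2 / d) = (1 - 2 / (d : ℝ)) + 1 := by field_simp; ring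
  rw [h3, Real.rpow_add hq0, Real.rpow_one] at h1
  have h4 : q ^ (1 - 2 / (d : ℝ)) * q / 2 ≤ N ^ (2 / (d : ℝ)) := by
    refine le_trans ?_ h1
    gcongr
  rw [mul_div_assoc', le_div_iff₀ hq0]
  linarith

theorem small_error_le (hd : 3 ≤ d) (hq : 5 ≤ q) (hN : q ^ d ≤ 2 * q * N) :
    q ^ (-(1 / 3) : ℝ) * N ^ (2 / (3 * (d : ℝ))) ≤ N ^ (2 / (d : ℝ)) / q := by
  have h : (3 : ℝ) ≤ d := by exact_mod_cast hd
  have hq0 : 0 < q := by linarith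
  have hN2 : q ^ ((d : ℝ) / 2) ≤ N := by
    have h1 : q ^ ((d : ℝ) - 1) / 2 ≤ N := by
      rw [Real.rpow_sub hq0, Real.rpow_natCast, Real.rpow_one, div_div, div_le_iff₀ (by linarith)]
      linarith
    refine le_trans ?_ h1
    have h2 : (2 : ℝ) ≤ q ^ ((d : ℝ) / 2 - 1) := by
      calc (2 : ℝ) ≤ √q := by
            rw [Real.le_sqrt' (by norm_num)]; linarith
        _ = q ^ (1 / 2 : ℝ) := Real.sqrt_eq_rpow q
        _ ≤ _ := Real.rpow_le_rpow_of_exponent_le (by linarith) (by linarith)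
    have h3 : q ^ ((d : ℝ) - 1) = q ^ ((d : ℝ) / 2) * q ^ ((d : ℝ) / 2 - 1) := by
      rw [← Real.rpow_add hq0]; congr 1; ring
    rw [h3, le_div_iff₀ (by norm_num)]
    gcongr
  have hN0 : 0 < N := (Real.rpow_pos_of_pos hq0 _).trans_le hN2
  have h4 : q ^ (2 / 3 : ℝ) ≤ N ^ (4 / (3 * (d : ℝ))) := by
    calc q ^ (2 / 3 : ℝ) = (q ^ ((d : ℝ) / 2)) ^ (4 / (3 * (d : ℝ))) := by
          rw [← Real.rpow_mul hq0.le]; congr 1; field_simp; norm_num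
      _ ≤ _ := Real.rpow_le_rpow (by positivity) hN2 (by positivity)
  have h5 : N ^ (2 / (d : ℝ)) = N ^ (4 / (3 * (d : ℝ))) * N ^ (2 / (3 * (d : ℝ))) := by
    rw [← Real.rpow_add hN0]; congr 1; field_simp; norm_num
  have h6 : q ^ (-(1 / 3) : ℝ) = q ^ (2 / 3 : ℝ) / q := by
    nth_rewrite 3 [← Real.rpow_one q]
    rw [← Real.rpow_sub hq0]; norm_num
  rw [h5, h6, div_mul_eq_mul_div]
  gcongr

/-- The threshold `q ^ (-(e / p))`, above which `f` with `∑ f ^ p ≤ 1` takes at most `q ^ e`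
values. -/
def threshold (q : ℝ) (d : ℕ) (e : ℝ) : ℝ := q ^ (-(e * (1 / extExp d)))

theorem threshold_pos (hq : 0 < q) (e : ℝ) : 0 < threshold q d e := Real.rpow_pos_of_pos hq _

theorem threshold_rpow (hd : 3 ≤ d) (hq : 0 < q) (e r : ℝ) :
    threshold q d e ^ (r - extExp d) = q ^ (e * (1 - r * ((3 - 2 / (d : ℝ)) / 4))) := by
  have hp : extExp d ≠ 0 := by have := (extExp_bounds hd).1; linarith
  rw [threshold, ← Real.rpow_mul hq.le, ← extExp_inv hd]
  congr 1
  field_simp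
  ring

end Exponents

section Pieces

variable {F : Type*} [Field F] [Fintype F] {d : ℕ}

theorem energy_large_le (hd : 3 ≤ d) (V : Finset (Fin d → F)) (f : (Fin d → F) → ℝ)
    (hf : ∀ x, 0 ≤ f x) (hsum : ∑ x ∈ V, f x ^ extExp d ≤ 1)
    (ht : ∀ x, f x = 0 ∨ threshold (Fintype.card F) d (((d : ℝ) - 2) / 2) ≤ f x) :
    energy V f ≤ (Fintype.card F : ℝ) ^ (1 - 2 / (d : ℝ)) := by
  have h : (3 : ℝ) ≤ d := by exact_mod_cast hd
  have hq : (0 : ℝ) < Fintype.card F := by exact_mod_cast Fintype.card_pos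
  have h1 := energy_le_sum_pow V f (fun x => f x ^ (4 / 3 : ℝ))
    (fun x => Real.rpow_nonneg (hf x) _)
    (fun a b c e => mul_four_le_rpow (hf a) (hf b) (hf c) (hf e))
  have h2 := sum_rpow_le_of_eq_zero_or_le V f hf (by norm_num : (0 : ℝ) < 4 / 3)
    (extExp_bounds hd).1 ht hsum (threshold_pos hq _)
  rw [threshold_rpow hd hq] at h2
  refine h1.trans ((pow_le_pow_left₀ (Finset.sum_nonneg fun x _ =>
    Real.rpow_nonneg (hf x) _) h2 3).trans_eq ?_)
  rw [← Real.rpow_natCast, ← Real.rpow_mul hq.le]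
  congr 1
  push_cast
  field_simp
  ring

variable {χ : AddChar F ℂ} {i g : F} {l : ℕ}

theorem energy_medium_le (hχ : χ ≠ 1) (h2 : (2 : F) ≠ 0) (hi : i ^ 2 = -1)
    (hq5 : 5 ≤ Fintype.card F) (hg : ¬IsSquare g) (hdl : d + 1 = 2 * l) (hd : 3 ≤ d)
    (V : Finset (Fin d → F)) (hV : ∀ x ∈ V, x ⬝ᵥ x = g) (f : (Fin d → F) → ℝ)
    (hf : ∀ x, 0 ≤ f x) (hsum : ∑ x ∈ V, f x ^ extExp d ≤ 1)
    (ht : ∀ x, f x = 0 ∨ threshold (Fintype.card F) d ((d : ℝ) / 2) ≤ f x)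
    (ht' : ∀ x, f x ≤ threshold (Fintype.card F) d (((d : ℝ) - 2) / 2)) :
    energy V f ≤ 6 * (Fintype.card F : ℝ) ^ (1 - 2 / (d : ℝ)) := by
  have h : (3 : ℝ) ≤ d := by exact_mod_cast hd
  have hq : (0 : ℝ) < Fintype.card F := by exact_mod_cast Fintype.card_pos
  have hq1 : (1 : ℝ) ≤ Fintype.card F := by exact_mod_cast Fintype.card_pos
  have h1 := energy_le hχ h2 hi hq5 hg hdl V hV f f (fun x => f x ^ 2) hf hf
    (fun x => sq_nonneg _) (fun a b c e => mul_four_le_sq _ _ _ _ (hf a) (hf b) (hf c) (hf e))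
  have hp := extExp_bounds hd
  have hB := sum_rpow_le_of_forall_le V f hf (by linarith) hp.2 ht' hsum
    (threshold_pos hq _).le
  have hA := sum_rpow_le_of_eq_zero_or_le V f hf one_pos (by linarith) ht hsum
    (threshold_pos hq _)
  rw [threshold_rpow hd hq] at hA hB
  simp only [Real.rpow_two, Real.rpow_one] at hA hB
  have hA0 : 0 ≤ ∑ x ∈ V, f x := Finset.sum_nonneg fun x _ => hf x
  have hB0 : 0 ≤ ∑ x ∈ V, f x ^ 2 := Finset.sum_nonneg fun x _ => sq_nonneg _
  unfold pairBound at h1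
  set q : ℝ := (Fintype.card F : ℝ) with hqdef
  set b := q ^ (((d : ℝ) - 2) / 2 * (1 - 2 * ((3 - 2 / (d : ℝ)) / 4))) with hb
  set a := q ^ ((d : ℝ) / 2 * (1 - 1 * ((3 - 2 / (d : ℝ)) / 4))) with ha
  have hinv : q⁻¹ = q ^ (-1 : ℝ) := (Real.rpow_neg_one q).symm
  have hsqrt : √(q ^ d) = q ^ ((d : ℝ) / 2) := by
    rw [Real.sqrt_eq_rpow, ← Real.rpow_natCast, ← Real.rpow_mul hq.le]; congr 1; ring
  have e1 : b * (q⁻¹ * a ^ 2) ≤ q ^ (1 - 2 / (d : ℝ)) := by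
    rw [hinv, ha, hb, ← Real.rpow_natCast, ← Real.rpow_mul hq.le, ← Real.rpow_add hq,
      ← Real.rpow_add hq]
    refine Real.rpow_le_rpow_of_exponent_le hq1 ?_
    have : ((d : ℝ) - 2) / 2 * (1 - 2 * ((3 - 2 / (d : ℝ)) / 4)) +
        (-1 + (d : ℝ) / 2 * (1 - 1 * ((3 - 2 / (d : ℝ)) / 4)) * ((2 : ℕ) : ℝ)) =
        (1 - 2 / (d : ℝ)) / 2 := by
      push_cast; field_simp; ring
    rw [this]
    have : 2 / (d : ℝ) ≤ 1 := by rw [div_le_one (by linarith)]; linarith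
    linarith
  have e2 : b * (q⁻¹ * √(q ^ d) * b) = q ^ (1 - 2 / (d : ℝ)) := by
    rw [hsqrt, hinv, hb, ← Real.rpow_add hq, ← Real.rpow_add hq, ← Real.rpow_add hq]
    congr 1
    field_simp; ring
  have hb0 : 0 ≤ b := Real.rpow_nonneg hq.le _
  calc energy V f ≤ _ := h1
    _ ≤ 3 * (b * (q⁻¹ * a ^ 2 + q⁻¹ * √(q ^ d) * b)) := by gcongr
    _ = 3 * (b * (q⁻¹ * a ^ 2) + b * (q⁻¹ * √(q ^ d) * b)) := by ring
    _ ≤ _ := by rw [e2]; linarith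

theorem energy_small_le (hχ : χ ≠ 1) (h2 : (2 : F) ≠ 0) (hi : i ^ 2 = -1)
    (hq5 : 5 ≤ Fintype.card F) (hg : ¬IsSquare g) (hdl : d + 1 = 2 * l) (hd : 3 ≤ d)
    (V : Finset (Fin d → F)) (hV : ∀ x ∈ V, x ⬝ᵥ x = g) (hV0 : 0 < V.card)
    (hN : (Fintype.card F : ℝ) ^ d ≤ 2 * Fintype.card F * V.card) (f : (Fin d → F) → ℝ)
    (hf : ∀ x, 0 ≤ f x) (hsum : ∑ x ∈ V, f x ^ extExp d ≤ 1)
    (ht : ∀ x, f x ≤ threshold (Fintype.card F) d ((d : ℝ) / 2)) :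
    energy V f ≤ 30 * ((V.card : ℝ) ^ (2 / (d : ℝ)) / Fintype.card F) := by
  have h : (3 : ℝ) ≤ d := by exact_mod_cast hd
  have hq : (0 : ℝ) < Fintype.card F := by exact_mod_cast Fintype.card_pos
  have hq5' : (5 : ℝ) ≤ Fintype.card F := by exact_mod_cast hq5
  have hN0 : (0 : ℝ) < V.card := by exact_mod_cast hV0
  have hk : ∀ x, 0 ≤ f x ^ (4 / 3 : ℝ) := fun x => Real.rpow_nonneg (hf x) _
  have h1 := energy_le hχ h2 hi hq5 hg hdl V hV f (fun x => f x ^ (4 / 3 : ℝ))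
    (fun x => f x ^ (4 / 3 : ℝ)) hf hk hk
    (fun a b c e => mul_four_le_rpow (hf a) (hf b) (hf c) (hf e))
  have hp := extExp_bounds hd
  have hA := sum_rpow_le_card V f hf (by norm_num : (0 : ℝ) < 4 / 3) hp.1 hsum hV0
  have hB := sum_rpow_le_of_forall_le V f hf (by linarith)
    (by linarith : extExp d ≤ 8 / 3) ht hsum (threshold_pos hq _).le
  rw [threshold_rpow hd hq] at hB
  have hexpA : 1 - 4 / 3 / extExp d = 2 / (3 * (d : ℝ)) := by
    rw [div_eq_mul_one_div (4 / 3 : ℝ), extExp_inv hd]; field_simp; ring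
  rw [hexpA] at hA
  have hsq : ∀ x, (f x ^ (4 / 3 : ℝ)) ^ 2 = f x ^ (8 / 3 : ℝ) := fun x => by
    rw [← Real.rpow_natCast, ← Real.rpow_mul (hf x)]; norm_num
  have hA0 : 0 ≤ ∑ x ∈ V, f x ^ (4 / 3 : ℝ) := Finset.sum_nonneg fun x _ => hk x
  have hB0 : 0 ≤ ∑ x ∈ V, f x ^ (8 / 3 : ℝ) :=
    Finset.sum_nonneg fun x _ => Real.rpow_nonneg (hf x) _
  unfold pairBound at h1
  simp only [hsq] at h1
  have herr := small_error_le hd hq5' hN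
  set q : ℝ := (Fintype.card F : ℝ) with hqdef
  set N : ℝ := (V.card : ℝ) with hNdef
  set b := q ^ ((d : ℝ) / 2 * (1 - 8 / 3 * ((3 - 2 / (d : ℝ)) / 4))) with hb
  set a := N ^ (2 / (3 * (d : ℝ))) with ha
  have hinv : q⁻¹ = q ^ (-1 : ℝ) := (Real.rpow_neg_one q).symm
  have hsqrt : √(q ^ d) = q ^ ((d : ℝ) / 2) := by
    rw [Real.sqrt_eq_rpow, ← Real.rpow_natCast, ← Real.rpow_mul hq.le]; congr 1; ring
  have e1 : a ^ 3 = N ^ (2 / (d : ℝ)) := by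
    rw [ha, ← Real.rpow_natCast, ← Real.rpow_mul hN0.le]
    congr 1; push_cast; field_simp
  have e2 : q⁻¹ * √(q ^ d) * b = q ^ (-(1 / 3) : ℝ) := by
    rw [hsqrt, hinv, hb, ← Real.rpow_add hq, ← Real.rpow_add hq]
    congr 1
    field_simp; ring
  calc energy V f ≤ _ := h1
    _ ≤ 3 * (2 * a * (q⁻¹ * (2 * a) ^ 2 + q⁻¹ * √(q ^ d) * b)) := by gcongr
    _ = 24 * (a ^ 3 / q) + 6 * (q ^ (-(1 / 3) : ℝ) * a) := by rw [e2]; field_simp; ring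
    _ ≤ _ := by rw [e1]; linarith

theorem norm_add_three_pow_four_le (a b c : ℂ) :
    ‖a + b + c‖ ^ 4 ≤ 27 * (‖a‖ ^ 4 + ‖b‖ ^ 4 + ‖c‖ ^ 4) := by
  have h1 : ‖a + b + c‖ ≤ ‖a‖ + ‖b‖ + ‖c‖ := norm_add₃_le
  have h2 := pow_le_pow_left₀ (norm_nonneg _) h1 4
  refine h2.trans ?_
  generalize ‖a‖ = x
  generalize ‖b‖ = y
  generalize ‖c‖ = z
  have h3 : (x + y + z) ^ 2 ≤ 3 * (x ^ 2 + y ^ 2 + z ^ 2) := by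
    nlinarith [sq_nonneg (x - y), sq_nonneg (y - z), sq_nonneg (x - z)]
  have h4 : (x ^ 2 + y ^ 2 + z ^ 2) ^ 2 ≤ 3 * (x ^ 4 + y ^ 4 + z ^ 4) := by
    nlinarith [sq_nonneg (x ^ 2 - y ^ 2), sq_nonneg (y ^ 2 - z ^ 2), sq_nonneg (x ^ 2 - z ^ 2)]
  have h5 := pow_le_pow_left₀ (sq_nonneg _) h3 2
  nlinarith

theorem sum_norm_pow_four_normalized_le (hχ : χ ≠ 1) (h2 : (2 : F) ≠ 0) (hi : i ^ 2 = -1)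
    (hq5 : 5 ≤ Fintype.card F) (hg : ¬IsSquare g) (hdl : d + 1 = 2 * l) (hd : 3 ≤ d)
    (V : Finset (Fin d → F)) (hV : ∀ x ∈ V, x ⬝ᵥ x = g) (hV0 : 0 < V.card)
    (hN : (Fintype.card F : ℝ) ^ d ≤ 2 * Fintype.card F * V.card) (f : (Fin d → F) → ℂ)
    (hsum : ∑ x ∈ V, ‖f x‖ ^ extExp d ≤ 1) :
    ∑ m : Fin d → F, ‖∑ x ∈ V, χ (m ⬝ᵥ x) * f x‖ ^ 4 ≤
      2376 * (V.card : ℝ) ^ (1 + 2 / (d : ℝ)) := by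
  classical
  have hq : (0 : ℝ) < Fintype.card F := by exact_mod_cast Fintype.card_pos
  have hq5' : (5 : ℝ) ≤ Fintype.card F := by exact_mod_cast hq5
  have hN0 : (0 : ℝ) < V.card := by exact_mod_cast hV0
  have hp0 : extExp d ≠ 0 := by have := (extExp_bounds hd).1; linarith
  have hR := rpow_le_size hd hq5' hN
  set q : ℝ := (Fintype.card F : ℝ) with hqdef
  set N : ℝ := (V.card : ℝ) with hNdef
  set lam := threshold q d (((d : ℝ) - 2) / 2) with hlam
  set mu := threshold q d ((d : ℝ) / 2) with hmu
  set R := N ^ (2 / (d : ℝ)) / q with hRdef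
  have hlam0 : 0 < lam := threshold_pos hq _
  have hmu0 : 0 < mu := threshold_pos hq _
  have hrestr : ∀ P : (Fin d → F) → Prop,
      ∑ x ∈ V, ‖if P x then f x else 0‖ ^ extExp d ≤ 1 := by
    intro P
    refine le_trans (Finset.sum_le_sum fun x _ => ?_) hsum
    split_ifs
    · exact le_rfl
    · rw [norm_zero, Real.zero_rpow hp0]; exact Real.rpow_nonneg (norm_nonneg _) _
  obtain ⟨P₁, hP₁⟩ : ∃ P : (Fin d → F) → Prop, ∀ x, P x ↔ lam < ‖f x‖ :=
    ⟨_, fun _ => Iff.rfl⟩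
  obtain ⟨P₂, hP₂⟩ : ∃ P : (Fin d → F) → Prop, ∀ x, P x ↔ ‖f x‖ ≤ lam ∧ mu < ‖f x‖ :=
    ⟨_, fun _ => Iff.rfl⟩
  obtain ⟨P₃, hP₃⟩ : ∃ P : (Fin d → F) → Prop, ∀ x, P x ↔ ‖f x‖ ≤ lam ∧ ‖f x‖ ≤ mu :=
    ⟨_, fun _ => Iff.rfl⟩
  have hdecomp : ∀ x, f x = (if P₁ x then f x else 0) + (if P₂ x then f x else 0) +
      (if P₃ x then f x else 0) := by
    intro x
    rcases lt_or_ge lam ‖f x‖ with ha | ha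
    · simp [hP₁, hP₂, hP₃, ha, not_le.mpr ha]
    · rcases lt_or_ge mu ‖f x‖ with hb | hb
      · simp [hP₁, hP₂, hP₃, ha, hb, not_lt.mpr ha, not_le.mpr hb]
      · simp [hP₁, hP₂, hP₃, ha, hb, not_lt.mpr ha, not_lt.mpr hb]
  have hE1 : energy V (fun x => ‖if P₁ x then f x else 0‖) ≤ 2 * R :=
    (energy_large_le hd V _ (fun x => norm_nonneg _) (hrestr P₁) (fun x => by
      by_cases hx : P₁ x
      · right; rw [if_pos hx]; exact ((hP₁ x).mp hx).le
      · left; rw [if_neg hx, norm_zero])).trans hR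
  have hE2 : energy V (fun x => ‖if P₂ x then f x else 0‖) ≤ 12 * R :=
    (energy_medium_le hχ h2 hi hq5 hg hdl hd V hV _ (fun x => norm_nonneg _) (hrestr P₂)
      (fun x => by
        by_cases hx : P₂ x
        · right; rw [if_pos hx]; exact ((hP₂ x).mp hx).2.le
        · left; rw [if_neg hx, norm_zero])
      (fun x => by
        by_cases hx : P₂ x
        · rw [if_pos hx]; exact ((hP₂ x).mp hx).1
        · rw [if_neg hx, norm_zero]; exact hlam0.le)).trans (by linarith)
  have hE3 : energy V (fun x => ‖if P₃ x then f x else 0‖) ≤ 30 * R :=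
    energy_small_le hχ h2 hi hq5 hg hdl hd V hV hV0 hN _ (fun x => norm_nonneg _) (hrestr P₃)
      (fun x => by
        by_cases hx : P₃ x
        · rw [if_pos hx]; exact ((hP₃ x).mp hx).2
        · rw [if_neg hx, norm_zero]; exact hmu0.le)
  have hF := fun P : (Fin d → F) → Prop =>
    sum_norm_pow_four_le hχ V (fun x => if P x then f x else 0)
  have hqd : 0 ≤ q ^ d := pow_nonneg hq.le d
  have hR0 : 0 ≤ R := div_nonneg (Real.rpow_nonneg hN0.le _) hq.le
  calc ∑ m : Fin d → F, ‖∑ x ∈ V, χ (m ⬝ᵥ x) * f x‖ ^ 4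
      ≤ ∑ m : Fin d → F, 27 * (‖∑ x ∈ V, χ (m ⬝ᵥ x) * (if P₁ x then f x else 0)‖ ^ 4 +
          ‖∑ x ∈ V, χ (m ⬝ᵥ x) * (if P₂ x then f x else 0)‖ ^ 4 +
          ‖∑ x ∈ V, χ (m ⬝ᵥ x) * (if P₃ x then f x else 0)‖ ^ 4) := by
        refine Finset.sum_le_sum fun m _ => ?_
        refine le_trans (le_of_eq ?_) (norm_add_three_pow_four_le _ _ _)
        rw [← Finset.sum_add_distrib, ← Finset.sum_add_distrib]
        congr 2
        refine Finset.sum_congr rfl fun x _ => ?_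
        rw [← mul_add, ← mul_add, ← hdecomp x]
    _ ≤ 27 * (q ^ d * (2 * R) + q ^ d * (12 * R) + q ^ d * (30 * R)) := by
        rw [← Finset.mul_sum, Finset.sum_add_distrib, Finset.sum_add_distrib]
        exact mul_le_mul_of_nonneg_left (add_le_add (add_le_add
          ((hF P₁).trans (mul_le_mul_of_nonneg_left hE1 hqd))
          ((hF P₂).trans (mul_le_mul_of_nonneg_left hE2 hqd)))
          ((hF P₃).trans (mul_le_mul_of_nonneg_left hE3 hqd))) (by norm_num)
    _ = 1188 * R * q ^ d := by ring
    _ ≤ 1188 * R * (2 * q * N) := mul_le_mul_of_nonneg_left hN (by linarith)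
    _ = 2376 * (N * N ^ (2 / (d : ℝ))) := by
        have hRq : R * q = N ^ (2 / (d : ℝ)) := div_mul_cancel₀ _ hq.ne'
        linear_combination 2376 * N * hRq
    _ = _ := by rw [Real.rpow_add hN0, Real.rpow_one]

/-- The extension estimate in terms of sums. -/
theorem sum_norm_pow_four_le_rpow (hχ : χ ≠ 1) (h2 : (2 : F) ≠ 0) (hi : i ^ 2 = -1)
    (hq5 : 5 ≤ Fintype.card F) (hg : ¬IsSquare g) (hdl : d + 1 = 2 * l) (hd : 3 ≤ d)
    (V : Finset (Fin d → F)) (hV : ∀ x ∈ V, x ⬝ᵥ x = g) (hV0 : 0 < V.card)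
    (hN : (Fintype.card F : ℝ) ^ d ≤ 2 * Fintype.card F * V.card) (f : (Fin d → F) → ℂ) :
    ∑ m : Fin d → F, ‖∑ x ∈ V, χ (m ⬝ᵥ x) * f x‖ ^ 4 ≤
      2376 * (V.card : ℝ) ^ (1 + 2 / (d : ℝ)) *
        ((∑ x ∈ V, ‖f x‖ ^ extExp d) ^ (1 / extExp d)) ^ 4 := by
  have hp := extExp_bounds hd
  have hp0 : 0 < extExp d := by linarith
  set P := ∑ x ∈ V, ‖f x‖ ^ extExp d with hP
  have hP0 : 0 ≤ P := Finset.sum_nonneg fun x _ => Real.rpow_nonneg (norm_nonneg _) _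
  rcases hP0.eq_or_lt with h0 | hpos
  · have hz : ∀ x ∈ V, f x = 0 := by
      intro x hx
      have := (Finset.sum_eq_zero_iff_of_nonneg
        (fun x _ => Real.rpow_nonneg (norm_nonneg (f x)) _)).mp h0.symm x hx
      rwa [Real.rpow_eq_zero (norm_nonneg _) hp0.ne', norm_eq_zero] at this
    have : ∑ m : Fin d → F, ‖∑ x ∈ V, χ (m ⬝ᵥ x) * f x‖ ^ 4 = 0 := by
      refine Finset.sum_eq_zero fun m _ => ?_
      rw [Finset.sum_eq_zero fun x hx => by rw [hz x hx, mul_zero]]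
      simp
    rw [this]
    positivity
  · set c := P ^ (1 / extExp d) with hc
    have hc0 : 0 < c := Real.rpow_pos_of_pos hpos _
    have hcp : c ^ extExp d = P := by
      rw [hc, ← Real.rpow_mul hP0, one_div_mul_cancel hp0.ne', Real.rpow_one]
    have hcn : ∀ x, ‖f x / (c : ℂ)‖ = ‖f x‖ / c := fun x => by
      rw [norm_div, Complex.norm_real, Real.norm_of_nonneg hc0.le]
    have hnorm := sum_norm_pow_four_normalized_le hχ h2 hi hq5 hg hdl hd V hV hV0 hN
      (fun x => f x / (c : ℂ)) (by
        simp only [hcn, Real.div_rpow (norm_nonneg _) hc0.le, hcp]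
        rw [← Finset.sum_div, ← hP, div_self hpos.ne'])
    have hlhs : ∑ m : Fin d → F, ‖∑ x ∈ V, χ (m ⬝ᵥ x) * (f x / (c : ℂ))‖ ^ 4 =
        (∑ m : Fin d → F, ‖∑ x ∈ V, χ (m ⬝ᵥ x) * f x‖ ^ 4) / c ^ 4 := by
      rw [Finset.sum_div]
      refine Finset.sum_congr rfl fun m _ => ?_
      simp only [mul_div_assoc', ← Finset.sum_div]
      rw [norm_div, Complex.norm_real, Real.norm_of_nonneg hc0.le, div_pow]
    rw [hlhs, div_le_iff₀ (by positivity)] at hnorm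
    exact hnorm

end Pieces

section Norms

theorem lintegral_count_top {α : Type*} [Fintype α] (φ : α → ℝ≥0∞) :
    @lintegral α ⊤ (@Measure.count α ⊤) φ = ∑ a, φ a := by
  rw [@lintegral_count α ⊤ (@MeasurableSingletonClass.mk α ⊤ fun _ => trivial) φ,
    tsum_fintype]

theorem eLpNorm_countingMeasure {F : Type*} [Fintype F] {d : ℕ} (u : (Fin d → F) → ℂ) :
    eLpNorm u 4 (countingMeasure F d) = ENNReal.ofReal ((∑ m, ‖u m‖ ^ 4) ^ (1 / 4 : ℝ)) := by
  classical
  rw [eLpNorm_eq_lintegral_rpow_enorm_toReal (by norm_num) (by norm_num), countingMeasure,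
    lintegral_count_top]
  have h4 : (4 : ℝ≥0∞).toReal = 4 := by norm_num
  rw [h4, ← ENNReal.ofReal_rpow_of_nonneg (Finset.sum_nonneg fun m _ => by positivity)
    (by norm_num), ENNReal.ofReal_sum_of_nonneg fun m _ => by positivity]
  congr 1
  refine Finset.sum_congr rfl fun m _ => ?_
  rw [← ofReal_norm, ENNReal.ofReal_rpow_of_nonneg (norm_nonneg _) (by norm_num)]
  congr 1
  exact_mod_cast Real.rpow_natCast _ 4

theorem eLpNorm_surfaceMeasure {F : Type*} {d : ℕ} (V : Finset (Fin d → F)) (hV : 0 < V.card)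
    {p : ℝ} (hp : 0 < p) (f : V → ℂ) :
    eLpNorm f (ENNReal.ofReal p) (surfaceMeasure V) =
      ENNReal.ofReal (((V.card : ℝ)⁻¹ * ∑ x, ‖f x‖ ^ p) ^ (1 / p)) := by
  rw [eLpNorm_eq_lintegral_rpow_enorm_toReal (by simpa using hp) ENNReal.ofReal_ne_top,
    surfaceMeasure, lintegral_smul_measure, lintegral_count_top, ENNReal.toReal_ofReal hp.le,
    ← ENNReal.ofReal_rpow_of_nonneg (mul_nonneg (by positivity)
      (Finset.sum_nonneg fun x _ => Real.rpow_nonneg (norm_nonneg _) _)) (by positivity),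
    ENNReal.ofReal_mul (by positivity),
    ENNReal.ofReal_sum_of_nonneg fun x _ => Real.rpow_nonneg (norm_nonneg _) _,
    ENNReal.ofReal_inv_of_pos (by exact_mod_cast hV), ENNReal.ofReal_natCast, smul_eq_mul]
  congr 2
  refine Finset.sum_congr rfl fun x _ => ?_
  rw [← ofReal_norm, ENNReal.ofReal_rpow_of_nonneg (norm_nonneg _) hp.le]

end Norms

theorem IsPrimitiveElement.not_isSquare {F : Type*} [Field F] [Fintype F] {g : F}
    (hg : IsPrimitiveElement g) (hF : ringChar F ≠ 2) : ¬IsSquare g := by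
  obtain ⟨u, rfl, hu⟩ := hg
  rintro ⟨a, ha⟩
  obtain ⟨b, hb⟩ := FiniteField.exists_nonsquare hF
  have hb0 : b ≠ 0 := by rintro rfl; exact hb (IsSquare.zero)
  obtain ⟨n, hn⟩ := Subgroup.mem_zpowers_iff.mp (hu (Units.mk0 b hb0))
  apply hb
  refine ⟨a ^ n, ?_⟩
  have : (u : F) ^ n = b := by
    rw [← Units.val_zpow_eq_zpow_val, hn, Units.val_mk0]
  rw [← this, ha, mul_zpow]

theorem extension_le {F : Type*} [Field F] [Fintype F] {χ : AddChar F ℂ} {i g : F} {d l : ℕ}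
    (hχ : χ ≠ 1) (h2 : (2 : F) ≠ 0) (hi : i ^ 2 = -1) (hq5 : 5 ≤ Fintype.card F)
    (hg : ¬IsSquare g) (hdl : d + 1 = 2 * l) (hd : 3 ≤ d) (V : Finset (Fin d → F))
    (hV : ∀ x ∈ V, x ⬝ᵥ x = g) (hV0 : 0 < V.card)
    (hN : (Fintype.card F : ℝ) ^ d ≤ 2 * Fintype.card F * V.card) :
    extensionConstant χ V (ENNReal.ofReal (extExp d)) 4 ≤ ENNReal.ofReal 7 := by
  classical
  refine sInf_le fun f => ?_
  have hp := extExp_bounds hd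
  have hp0 : 0 < extExp d := by linarith
  have hN0 : (0 : ℝ) < V.card := by exact_mod_cast hV0
  rw [eLpNorm_countingMeasure, eLpNorm_surfaceMeasure V hV0 hp0, ← ENNReal.ofReal_mul (by norm_num)]
  apply ENNReal.ofReal_le_ofReal
  set f' : (Fin d → F) → ℂ := fun x => if h : x ∈ V then f ⟨x, h⟩ else 0 with hf'
  have hff' : ∀ x : V, f x = f' x := fun x => by simp [hf']
  have hmain := sum_norm_pow_four_le_rpow hχ h2 hi hq5 hg hdl hd V hV hV0 hN f'
  have hext : ∀ m, ‖extension χ V f m‖ ^ 4 =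
      ((V.card : ℝ)⁻¹) ^ 4 * ‖∑ x ∈ V, χ (m ⬝ᵥ x) * f' x‖ ^ 4 := by
    intro m
    simp only [extension, hff']
    rw [Finset.sum_coe_sort V (fun x => χ (m ⬝ᵥ x) * f' x), norm_mul, mul_pow, norm_inv,
      Complex.norm_natCast]
  have hsum : ∑ x : V, ‖f x‖ ^ extExp d = ∑ x ∈ V, ‖f' x‖ ^ extExp d := by
    simp only [hff']
    exact Finset.sum_coe_sort V (fun x => ‖f' x‖ ^ extExp d)
  simp only [hext]
  rw [hsum, ← Finset.mul_sum]
  set P := ∑ x ∈ V, ‖f' x‖ ^ extExp d with hP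
  have hP0 : 0 ≤ P := Finset.sum_nonneg fun x _ => Real.rpow_nonneg (norm_nonneg _) _
  set N : ℝ := (V.card : ℝ) with hNdef
  clear_value N
  rw [Real.mul_rpow (by positivity) hP0]
  set c := P ^ (1 / extExp d) with hc
  have hc0 : 0 ≤ c := Real.rpow_nonneg hP0 _
  have hNp : ((N⁻¹) ^ (1 / extExp d)) ^ 4 = (N⁻¹) ^ 4 * N ^ (1 + 2 / (d : ℝ)) := by
    rw [← Real.rpow_neg_one, ← Real.rpow_natCast, ← Real.rpow_natCast, ← Real.rpow_mul hN0.le,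
      ← Real.rpow_mul hN0.le, ← Real.rpow_mul hN0.le, ← Real.rpow_add hN0, extExp_inv hd]
    congr 1; push_cast; ring
  have hR0 : 0 ≤ 7 * ((N⁻¹) ^ (1 / extExp d) * c) := by positivity
  have hle : (N⁻¹) ^ 4 * ∑ m : Fin d → F, ‖∑ x ∈ V, χ (m ⬝ᵥ x) * f' x‖ ^ 4 ≤
      (7 * ((N⁻¹) ^ (1 / extExp d) * c)) ^ 4 := by
    calc _ ≤ (N⁻¹) ^ 4 * (2376 * N ^ (1 + 2 / (d : ℝ)) * c ^ 4) :=
          mul_le_mul_of_nonneg_left hmain (by positivity)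
      _ = 2376 * (((N⁻¹) ^ 4 * N ^ (1 + 2 / (d : ℝ))) * c ^ 4) := by ring
      _ ≤ 2401 * (((N⁻¹) ^ 4 * N ^ (1 + 2 / (d : ℝ))) * c ^ 4) :=
          mul_le_mul_of_nonneg_right (by norm_num) (by positivity)
      _ = _ := by rw [← hNp]; ring
  calc _ ≤ ((7 * ((N⁻¹) ^ (1 / extExp d) * c)) ^ 4) ^ (1 / 4 : ℝ) :=
        Real.rpow_le_rpow (mul_nonneg (by positivity)
          (Finset.sum_nonneg fun m _ => by positivity)) hle (by norm_num)
    _ = _ := by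
        rw [← Real.rpow_natCast, ← Real.rpow_mul hR0]
        norm_num

end FiniteFieldExtension

end

theorem theorem1p9 :
    ∃ C : ℝ, 0 < C ∧
      ∀ (F : Type*) [Field F] [Fintype F] (χ : AddChar F ℂ) (g : F) (k d : ℕ),
        χ ≠ 1 →
        Fintype.card F % 4 = 1 →
        FiniteFieldExtension.IsPrimitiveElement g →
        1 ≤ k →
        d = 4 * k - 1 →
        FiniteFieldExtension.extensionConstant χ (FiniteFieldExtension.sphere d g)
            (ENNReal.ofReal (4 * (d : ℝ) / (3 * (d : ℝ) - 2))) 4 ≤ ENNReal.ofReal C := by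
  refine ⟨7, by norm_num, fun F _ _ χ g k d hχ hq hg hk hd => ?_⟩
  have hq5 : 5 ≤ Fintype.card F := by
    have := Fintype.one_lt_card (α := F)
    omega
  have hF : ringChar F ≠ 2 := by
    intro h
    have := FiniteField.even_card_iff_char_two.mp h
    omega
  have h2 : (2 : F) ≠ 0 := Ring.two_ne_zero hF
  obtain ⟨i, hi⟩ := FiniteField.isSquare_neg_one_iff (F := F) |>.mpr (by omega)
  have hi' : i ^ 2 = -1 := by rw [hi, sq]
  obtain ⟨n, rfl⟩ : ∃ n, d = n + 2 := ⟨d - 2, by omega⟩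
  have hcard := FiniteFieldExtension.le_card_sphere h2 hi' g n
  have hpos : 0 < (FiniteFieldExtension.sphere (n + 2) g).card :=
    lt_of_lt_of_le (Nat.mul_pos (by omega) (pow_pos (by omega) n)) hcard
  refine FiniteFieldExtension.extension_le (l := 2 * k) hχ h2 hi' hq5 (hg.not_isSquare hF)
    (by omega) (by omega) _ (fun x hx => FiniteFieldExtension.mem_sphere.mp hx) hpos ?_
  have h3 : Fintype.card F ^ (n + 2) ≤
      2 * Fintype.card F * (FiniteFieldExtension.sphere (n + 2) g).card := by
    calc Fintype.card F ^ (n + 2) = Fintype.card F * (Fintype.card F * Fintype.card F ^ n) := by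
          ring
      _ ≤ Fintype.card F * (2 * (Fintype.card F - 1) * Fintype.card F ^ n) := by
          gcongr; omega
      _ = 2 * Fintype.card F * ((Fintype.card F - 1) * Fintype.card F ^ n) := by ring
      _ ≤ _ := Nat.mul_le_mul_left _ hcard
  exact_mod_cast h3
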